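/- Let $R$ be a commutative local ring whose residue field has characteristic $p>0$, and let $A=\{A_i\}_{i\ge 0}$ be a dg $R$-algebra: a non-negatively graded $R$-algebra with $ab=(-1)^{|a||b|}ba$ for homogeneous $a,b$ and $a^2=0$ for $|a|$ odd, with an $R$-linear differential $\partial$ of degree $-1$ satisfying $\partial^2=0$ and $\partial(ab)=\partial(a)b+(-1)^{|a|}a\,\partial(b)$. Let $z\in A$ be a cycle of odd degree. Let $A\langle y\mid\partial y=z\rangle$ be the divided power extension: the graded-commutative $A$-algebra that is free as an $A$-module on $\{y^{(n)}\}_{n\ge0}$, where $|y^{(n)}|=n(|z|+1)$, $y^{(0)}=1$, $y=y^{(1)}$, with $$y^{(m)}y^{(n)}=\binom{m+n}{m}y^{(m+n)},\qquad \partial(y^{(n)})=z\,y^{(n-1)}\ (n\ge 1).$$ Let $A[\{x_i,x'_{i+1}\}_{i\ge0}]$ be the semifree extension of $A$ (the free strictly graded-commutative $A$-algebra) on polynomial variables $x_i$ of even degree $p^i(|z|+1)$ and exterior variables $x'_{i+1}$ of odd degree $p^{i+1}(|z|+1)+1$, for $i\ge 0$, with differential extending that of $A$ and $$\partial x_i=z\,x_0^{p-1}x_1^{p-1}\cdots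 x_{i-1}^{p-1},\qquad \partial x'_{i+1}=x_i^p-p\,x_{i+1}.$$ For $j\ge0$ put $b_j=\dfrac{((p-1)p^j)!}{((p^j)!)^{p-1}}$. For $n\ge0$ with base $p$ expansion $n=n_0+n_1p+\cdots+n_lp^l$, $0\le n_i<p$, put $c_n=\dfrac{n!}{n_0!\,(n_1p)!\cdots(n_lp^l)!}$. For $i\ge 0$ put $$d_i=c_{p^i-1}\prod_{j=0}^{i-1}\bigl(b_j\,c_{p^j-1}^{\,p-1}\bigr)^{p^{i-1-j}}.$$ Then there is a unique morphism of dg $A$-algebras $$A[\{x_i,x'_{i+1}\}_{i\ge0}]\longrightarrow A\langle y\mid\partial y=z\rangle$$ with $x_i\mapsto d_i\,y^{(p^i)}$ and $x'_{i+1}\mapsto 0$ for all $i\ge0$, and this morphism is a quasi-isomorphism. -/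

import Mathlib

universe u v w

set_option linter.unusedSectionVars false

noncomputable section

/-! ### Differential graded algebras -/

section SignAut

variable {R : Type u} {A : Type v} [CommRing R] [Ring A] [Algebra R A]
  (𝒜 : ℕ → Submodule R A) [GradedAlgebra 𝒜]

/-- The linear map `a ↦ (-1) ^ |a| a`. -/
def signLin : A →ₗ[R] A :=
  (DirectSum.toModule R ℕ A fun i => ((-1 : ℤ) ^ i) • (𝒜 i).subtype) ∘ₗ
    (DirectSum.decomposeLinearEquiv 𝒜).toLinearMap

theorem signLin_of_mem {i : ℕ} {a : A} (ha : a ∈ 𝒜 i) :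
    signLin 𝒜 a = ((-1 : ℤ) ^ i) • a := by
  unfold signLin
  simp only [LinearMap.comp_apply, LinearEquiv.coe_coe, DirectSum.decomposeLinearEquiv_apply]
  rw [DirectSum.decompose_of_mem 𝒜 ha]
  erw [DirectSum.toModule_lof]
  simp

theorem signLin_one : signLin 𝒜 (1 : A) = 1 := by
  rw [signLin_of_mem 𝒜 (SetLike.GradedOne.one_mem)]; simp

theorem signLin_mul (a b : A) : signLin 𝒜 (a * b) = signLin 𝒜 a * signLin 𝒜 b := by
  induction a using DirectSum.Decomposition.inductionOn 𝒜 with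
  | zero => simp
  | add x y hx hy => simp [add_mul, hx, hy]
  | @homogeneous i x =>
    induction b using DirectSum.Decomposition.inductionOn 𝒜 with
    | zero => simp
    | add x y hx hy => simp [mul_add, hx, hy]
    | @homogeneous j y =>
      rw [signLin_of_mem 𝒜 x.2, signLin_of_mem 𝒜 y.2,
        signLin_of_mem 𝒜 (SetLike.GradedMul.mul_mem x.2 y.2)]
      rw [smul_mul_smul_comm, pow_add]

/-- The sign automorphism `a ↦ (-1) ^ |a| a` of a graded algebra. -/
def signAut : A →ₐ[R] A :=
  AlgHom.ofLinearMap (signLin 𝒜) (signLin_one 𝒜) (signLin_mul 𝒜)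

theorem signAut_of_mem {i : ℕ} {a : A} (ha : a ∈ 𝒜 i) :
    signAut 𝒜 a = ((-1 : ℤ) ^ i) • a := signLin_of_mem 𝒜 ha

theorem signAut_pow_of_mem {i : ℕ} (k : ℕ) {a : A} (ha : a ∈ 𝒜 i) :
    (signAut 𝒜 ^ k) a = ((-1 : ℤ) ^ (k * i)) • a := by
  induction k with
  | zero => simp
  | succ k ih =>
    rw [pow_succ', AlgHom.mul_apply, ih, map_zsmul, signAut_of_mem 𝒜 ha, smul_smul, ← pow_add]
    congr 2; ring

end SignAut

/-- A strictly graded-commutative dg algebra `A = {A_i}_{i ≥ 0}` over `R`: an `ℕ`-graded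
`R`-algebra with a differential of degree `-1` satisfying the Leibniz rule. -/
structure DGAlgebra (R : Type u) [CommRing R] where
  carrier : Type v
  [ring : Ring carrier]
  [algebra : Algebra R carrier]
  gr : ℕ → Submodule R carrier
  [graded : GradedAlgebra gr]
  comm : ∀ {i j : ℕ} {a b : carrier}, a ∈ gr i → b ∈ gr j →
    a * b = ((-1 : ℤ) ^ (i * j)) • (b * a)
  sq_zero : ∀ {i : ℕ} {a : carrier}, Odd i → a ∈ gr i → a * a = 0
  d : carrier →ₗ[R] carrier
  d_gr_zero : ∀ {a : carrier}, a ∈ gr 0 → d a = 0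
  d_gr_succ : ∀ {i : ℕ} {a : carrier}, a ∈ gr (i + 1) → d a ∈ gr i
  d_d : ∀ a : carrier, d (d a) = 0
  d_mul : ∀ {i : ℕ} {a : carrier} (b : carrier), a ∈ gr i →
    d (a * b) = d a * b + ((-1 : ℤ) ^ i) • (a * d b)

attribute [instance] DGAlgebra.ring DGAlgebra.algebra DGAlgebra.graded

/-- A morphism of dg `R`-algebras. -/
structure DGHom {R : Type u} [CommRing R] (A B : DGAlgebra.{u, v} R) where
  toAlgHom : A.carrier →ₐ[R] B.carrier
  map_gr : ∀ {n : ℕ} {a : A.carrier}, a ∈ A.gr n → toAlgHom a ∈ B.gr n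
  map_d : ∀ a : A.carrier, toAlgHom (A.d a) = B.d (toAlgHom a)

instance {R : Type u} [CommRing R] (A B : DGAlgebra.{u, v} R) :
    CoeFun (DGHom A B) fun _ => A.carrier → B.carrier := ⟨fun f => f.toAlgHom⟩

namespace DGAlgebra

variable {R : Type u} [CommRing R] (A : DGAlgebra.{u, v} R)

/-- The cycles of degree `n`. -/
def cycles (n : ℕ) : Submodule R A.carrier := A.gr n ⊓ LinearMap.ker A.d

/-- The boundaries of degree `n`. -/
def boundaries (n : ℕ) : Submodule R A.carrier := (A.gr (n + 1)).map A.d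

/-- The homology module `H_n(A)`. -/
abbrev Homology (n : ℕ) : Type v := A.cycles n ⧸ (A.boundaries n).submoduleOf (A.cycles n)

end DGAlgebra

namespace DGHom

variable {R : Type u} [CommRing R] {A B C : DGAlgebra.{u, v} R}

/-- The composite of two morphisms. -/
def comp (g : DGHom B C) (f : DGHom A B) : DGHom A C where
  toAlgHom := g.toAlgHom.comp f.toAlgHom
  map_gr := fun h => g.map_gr (f.map_gr h)
  map_d := fun a => by simp [f.map_d, g.map_d]

/-- The map induced on cycles. -/
def mapCycles (f : DGHom A B) (n : ℕ) : A.cycles n →ₗ[R] B.cycles n :=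
  f.toAlgHom.toLinearMap.restrict fun a ha =>
    ⟨f.map_gr ha.1, by
      have h : A.d a = 0 := ha.2
      change B.d (f a) = 0
      rw [← f.map_d, h, map_zero]⟩

/-- The map `H_n(f) : H_n(A) → H_n(B)`. -/
def mapHomology (f : DGHom A B) (n : ℕ) : A.Homology n →ₗ[R] B.Homology n :=
  Submodule.mapQ _ _ (f.mapCycles n) (by
    rintro ⟨x, hx⟩ ⟨y, hy, hyx⟩
    exact ⟨f y, f.map_gr hy, by
      change B.d (f y) = f x
      rw [← f.map_d]; exact congrArg _ hyx⟩)

/-- A quasi-isomorphism: an isomorphism on homology in every degree. -/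
def IsQuasiIso (f : DGHom A B) : Prop := ∀ n, Function.Bijective (f.mapHomology n)

end DGHom

/-! ### Adjoining monomials to a graded algebra -/

/-- The data needed to form the free module on a set `M` of monomials over a
graded-commutative algebra `A` as a graded-commutative `A`-algebra: the product of the monomials
`m` and `n` is the integer multiple `coeff m n` of the monomial `mul m n`. -/
structure MonomialSystem (M : Type w) where
  one : M
  mul : M → M → M
  coeff : M → M → ℤ
  deg : M → ℕ
  one_mul : ∀ m, mul one m = m
  mul_one : ∀ m, mul m one = m
  mul_assoc : ∀ l m n, mul (mul l m) n = mul l (mul m n)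
  mul_comm : ∀ m n, mul m n = mul n m
  coeff_one_left : ∀ m, coeff one m = 1
  coeff_one_right : ∀ m, coeff m one = 1
  coeff_assoc : ∀ l m n, coeff l m * coeff (mul l m) n = coeff m n * coeff l (mul m n)
  coeff_comm : ∀ m n, coeff m n = (-1) ^ (deg m * deg n) * coeff n m
  coeff_self : ∀ m, Odd (deg m) → coeff m m = 0
  deg_one : deg one = 0
  deg_mul : ∀ m n, coeff m n ≠ 0 → deg (mul m n) = deg m + deg n

section MonExt

variable {R : Type u} {A : Type v} [CommRing R] [Ring A] [Algebra R A]
  (𝒜 : ℕ → Submodule R A) [GradedAlgebra 𝒜] {M : Type w} (S : MonomialSystem M)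

/-- The free left `A`-module on the monomials of `S`, with the multiplication
`(a m) (b n) = (-1) ^ (|m| |b|) * coeff m n * (a b) (m n)`. -/
def MonExt (_ : ℕ → Submodule R A) (_ : MonomialSystem M) : Type (max v w) := M →₀ A

namespace MonExt

instance : AddCommGroup (MonExt 𝒜 S) := inferInstanceAs (AddCommGroup (M →₀ A))
instance : Module R (MonExt 𝒜 S) := inferInstanceAs (Module R (M →₀ A))

/-- The element `a m`, for `a ∈ A` and a monomial `m`. -/
def mono (m : M) : A →ₗ[R] MonExt 𝒜 S := Finsupp.lsingle m

variable {𝒜 S} in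
theorem mono_induction {P : MonExt 𝒜 S → Prop} (f : MonExt 𝒜 S) (zero : P 0)
    (add : ∀ f g, P f → P g → P (f + g)) (single : ∀ m a, P (mono 𝒜 S m a)) : P f :=
  Finsupp.induction_linear f zero add single

variable {𝒜 S} in
theorem hom_induction {P : MonExt 𝒜 S → Prop} (f : MonExt 𝒜 S) (zero : P 0)
    (add : ∀ f g, P f → P g → P (f + g))
    (single : ∀ m i a, a ∈ 𝒜 i → P (mono 𝒜 S m a)) : P f := by
  refine mono_induction f zero add fun m a => ?_
  induction a using DirectSum.Decomposition.inductionOn 𝒜 with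
  | zero => simpa using zero
  | add x y hx hy => rw [map_add]; exact add _ _ hx hy
  | @homogeneous i x => exact single m i x x.2

/-- The linear map out of `MonExt` with prescribed values on the elements `a m`. -/
def lift {N : Type*} [AddCommGroup N] [Module R N] (φ : M → A →ₗ[R] N) : MonExt 𝒜 S →ₗ[R] N :=
  Finsupp.lsum R φ

@[simp] theorem lift_mono {N : Type*} [AddCommGroup N] [Module R N] (φ : M → A →ₗ[R] N) (m : M)
    (a : A) : lift 𝒜 S φ (mono 𝒜 S m a) = φ m a :=
  Finsupp.lsum_single R φ m a

variable {𝒜 S} in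
theorem lin_ext {N : Type*} [AddCommGroup N] [Module R N] {φ ψ : MonExt 𝒜 S →ₗ[R] N}
    (h : ∀ m a, φ (mono 𝒜 S m a) = ψ (mono 𝒜 S m a)) : φ = ψ :=
  Finsupp.lhom_ext h

/-- The product `(a m) (b n)`, bilinear in `a` and `b`. -/
def mulMono (m n : M) : A →ₗ[R] A →ₗ[R] MonExt 𝒜 S :=
  ((LinearMap.mul R A).compl₂ (signAut 𝒜 ^ S.deg m).toLinearMap).compr₂
    (S.coeff m n • mono 𝒜 S (S.mul m n))

/-- The multiplication of `MonExt` as a bilinear map. -/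
def mulLin : MonExt 𝒜 S →ₗ[R] MonExt 𝒜 S →ₗ[R] MonExt 𝒜 S :=
  lift 𝒜 S fun m => (lift 𝒜 S fun n => (mulMono 𝒜 S m n).flip).flip

instance : Mul (MonExt 𝒜 S) := ⟨fun f g => mulLin 𝒜 S f g⟩
instance : One (MonExt 𝒜 S) := ⟨mono 𝒜 S S.one 1⟩

theorem mul_def (f g : MonExt 𝒜 S) : f * g = mulLin 𝒜 S f g := rfl
theorem one_def : (1 : MonExt 𝒜 S) = mono 𝒜 S S.one 1 := rfl

theorem mono_mul_mono (m n : M) (a b : A) :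
    mono 𝒜 S m a * mono 𝒜 S n b =
      S.coeff m n • mono 𝒜 S (S.mul m n) (a * (signAut 𝒜 ^ S.deg m) b) := by
  simp [mul_def, mulLin, mulMono]

theorem left_distrib' (f g h : MonExt 𝒜 S) : f * (g + h) = f * g + f * h := by
  simp [mul_def]

theorem right_distrib' (f g h : MonExt 𝒜 S) : (f + g) * h = f * h + g * h := by
  simp [mul_def]

theorem zero_mul' (f : MonExt 𝒜 S) : 0 * f = 0 := by simp [mul_def]

theorem mul_zero' (f : MonExt 𝒜 S) : f * 0 = 0 := by simp [mul_def]

theorem mul_assoc' (f g h : MonExt 𝒜 S) : f * g * h = f * (g * h) := by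
  induction f using mono_induction with
  | zero => simp [zero_mul']
  | add x y hx hy => simp [right_distrib', hx, hy]
  | single l a =>
  induction g using mono_induction with
  | zero => simp [zero_mul', mul_zero']
  | add x y hx hy => simp [right_distrib', left_distrib', hx, hy]
  | single m b =>
  induction h using mono_induction with
  | zero => simp [mul_zero']
  | add x y hx hy => simp [left_distrib', hx, hy]
  | single n c =>
  have e1 : ∀ (k : ℤ) (x y : MonExt 𝒜 S), (k • x) * y = k • (x * y) := fun k x y => by
    simp [mul_def]
  have e2 : ∀ (k : ℤ) (x y : MonExt 𝒜 S), x * (k • y) = k • (x * y) := fun k x y => by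
    simp [mul_def]
  rw [mono_mul_mono, mono_mul_mono, e1, e2, mono_mul_mono, mono_mul_mono, smul_smul, smul_smul,
    S.mul_assoc, S.coeff_assoc]
  by_cases h0 : S.coeff l m = 0
  · have : S.coeff m n * S.coeff l (S.mul m n) = 0 := by rw [← S.coeff_assoc, h0, zero_mul]
    rw [this]; simp
  · rw [S.deg_mul l m h0, map_mul (signAut 𝒜 ^ S.deg l), pow_add, AlgHom.mul_apply, mul_assoc]

instance : Ring (MonExt 𝒜 S) :=
  { (inferInstance : AddCommGroup (MonExt 𝒜 S)) with
    left_distrib := left_distrib' 𝒜 S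
    right_distrib := right_distrib' 𝒜 S
    zero_mul := zero_mul' 𝒜 S
    mul_zero := mul_zero' 𝒜 S
    mul_assoc := mul_assoc' 𝒜 S
    one_mul := fun f => by
      induction f using mono_induction with
      | zero => exact mul_zero' _ _ _
      | add x y hx hy => rw [left_distrib', hx, hy]
      | single m a =>
        rw [one_def, mono_mul_mono, S.one_mul, S.coeff_one_left, S.deg_one]; simp
    mul_one := fun f => by
      induction f using mono_induction with
      | zero => exact zero_mul' _ _ _
      | add x y hx hy => rw [right_distrib', hx, hy]
      | single m a =>
        rw [one_def, mono_mul_mono, S.mul_one, S.coeff_one_right]; simp }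

instance : Algebra R (MonExt 𝒜 S) :=
  Algebra.ofModule (fun r x y => by simp [mul_def]) (fun r x y => by simp [mul_def])

/-- The submodule of elements of degree `n`, spanned by the `a m` with `|a| + |m| = n`. -/
def gr (n : ℕ) : Submodule R (MonExt 𝒜 S) :=
  Submodule.span R {f | ∃ (m : M) (i : ℕ) (a : A), a ∈ 𝒜 i ∧ i + S.deg m = n ∧ mono 𝒜 S m a = f}

theorem mono_mem_gr {m : M} {i n : ℕ} {a : A} (ha : a ∈ 𝒜 i) (h : i + S.deg m = n) :
    mono 𝒜 S m a ∈ gr 𝒜 S n :=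
  Submodule.subset_span ⟨m, i, a, ha, h, rfl⟩

variable {𝒜 S} in
@[elab_as_elim]
theorem gr_induction {n : ℕ} {P : ∀ f, f ∈ gr 𝒜 S n → Prop}
    (zero : P 0 (zero_mem _))
    (add : ∀ f g hf hg, P f hf → P g hg → P (f + g) (add_mem hf hg))
    (single : ∀ m i a (ha : a ∈ 𝒜 i) (h : i + S.deg m = n),
      P (mono 𝒜 S m a) (mono_mem_gr 𝒜 S ha h))
    {f : MonExt 𝒜 S} (hf : f ∈ gr 𝒜 S n) : P f hf := by
  have key : ∀ r : R, ∃ h : r • f ∈ gr 𝒜 S n, P (r • f) h := by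
    refine Submodule.span_induction
      (p := fun x _ => ∀ r : R, ∃ h : r • x ∈ gr 𝒜 S n, P (r • x) h) ?_ ?_ ?_ ?_ hf
    · rintro _ ⟨m, i, a, ha, h, rfl⟩ r
      rw [← map_smul]
      exact ⟨_, single m i _ (Submodule.smul_mem _ r ha) h⟩
    · intro r; rw [smul_zero]; exact ⟨_, zero⟩
    · intro x y _ _ hx hy r
      rw [smul_add]
      obtain ⟨h1, h1'⟩ := hx r
      obtain ⟨h2, h2'⟩ := hy r
      exact ⟨_, add _ _ h1 h2 h1' h2'⟩
    · intro s x _ hx r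
      rw [smul_smul]; exact hx _
  obtain ⟨h, h'⟩ := key 1
  simpa only [one_smul] using h'

instance : SetLike.GradedMonoid (gr 𝒜 S) where
  one_mem := mono_mem_gr 𝒜 S SetLike.GradedOne.one_mem (by simp [S.deg_one])
  mul_mem := by
    intro n k f g hf hg
    induction hf using gr_induction with
    | zero => rw [zero_mul]; exact zero_mem _
    | add x y _ _ hx hy => rw [add_mul]; exact add_mem hx hy
    | single m i a ha h =>
    induction hg using gr_induction with
    | zero => rw [mul_zero]; exact zero_mem _
    | add x y _ _ hx hy => rw [mul_add]; exact add_mem hx hy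
    | single m' i' a' ha' h' =>
    rw [mono_mul_mono, signAut_pow_of_mem 𝒜 _ ha']
    by_cases h0 : S.coeff m m' = 0
    · rw [h0, zero_smul]; exact zero_mem _
    · refine zsmul_mem (mono_mem_gr 𝒜 S (i := i + i') ?_ ?_) _
      · rw [mul_smul_comm]
        exact zsmul_mem (SetLike.GradedMul.mul_mem ha ha') _
      · rw [S.deg_mul _ _ h0]; omega

/-- The decomposition of an element of `MonExt` into its homogeneous components. -/
def decomposeLin : MonExt 𝒜 S →ₗ[R] DirectSum ℕ fun n => gr 𝒜 S n :=
  lift 𝒜 S fun m =>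
    (DirectSum.toModule R ℕ _ fun i =>
      (DirectSum.lof R ℕ (fun n => gr 𝒜 S n) (i + S.deg m)) ∘ₗ
        ((mono 𝒜 S m ∘ₗ (𝒜 i).subtype).codRestrict (gr 𝒜 S (i + S.deg m))
          (fun a => mono_mem_gr 𝒜 S a.2 rfl))) ∘ₗ
    (DirectSum.decomposeLinearEquiv 𝒜).toLinearMap

theorem decomposeLin_mono {m : M} {i n : ℕ} {a : A} (ha : a ∈ 𝒜 i) (h : i + S.deg m = n) :
    decomposeLin 𝒜 S (mono 𝒜 S m a) =
      DirectSum.lof R ℕ (fun n => gr 𝒜 S n) n ⟨mono 𝒜 S m a, mono_mem_gr 𝒜 S ha h⟩ := by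
  subst h
  unfold decomposeLin
  rw [lift_mono]
  simp only [LinearMap.comp_apply, LinearEquiv.coe_coe, DirectSum.decomposeLinearEquiv_apply]
  rw [DirectSum.decompose_of_mem 𝒜 ha]
  erw [DirectSum.toModule_lof]
  rfl

theorem decomposeLin_of_mem {n : ℕ} {f : MonExt 𝒜 S} (hf : f ∈ gr 𝒜 S n) :
    decomposeLin 𝒜 S f = DirectSum.lof R ℕ (fun n => gr 𝒜 S n) n ⟨f, hf⟩ := by
  have key : ∀ hf : f ∈ gr 𝒜 S n,
      decomposeLin 𝒜 S f = DirectSum.lof R ℕ (fun n => gr 𝒜 S n) n ⟨f, hf⟩ := by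
    induction hf using gr_induction with
    | zero => intro hf; rw [map_zero]; symm; exact map_zero _
    | add x y hx hy ihx ihy =>
      intro hf; rw [map_add, ihx hx, ihy hy, ← map_add]; rfl
    | single m i a ha h => intro _; exact decomposeLin_mono 𝒜 S ha h
  exact key hf

instance : DirectSum.Decomposition (gr 𝒜 S) :=
  DirectSum.Decomposition.ofLinearMap (gr 𝒜 S) (decomposeLin 𝒜 S)
    (by
      ext f
      induction f using hom_induction with
      | zero => simp
      | add x y hx hy => rw [map_add, map_add, hx, hy]
      | single m i a ha =>
        rw [LinearMap.comp_apply, decomposeLin_mono 𝒜 S ha rfl, DirectSum.coeLinearMap_lof]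
        rfl)
    (by
      ext n f : 2
      rw [LinearMap.comp_apply, LinearMap.comp_apply, DirectSum.coeLinearMap_lof,
        decomposeLin_of_mem 𝒜 S f.2]
      rfl)

instance : GradedAlgebra (gr 𝒜 S) where

/-- Graded commutativity passes from `A` to `MonExt`. -/
theorem comm (hA : ∀ {i j : ℕ} {a b : A}, a ∈ 𝒜 i → b ∈ 𝒜 j →
      a * b = ((-1 : ℤ) ^ (i * j)) • (b * a)) {n k : ℕ} {f g : MonExt 𝒜 S}
    (hf : f ∈ gr 𝒜 S n) (hg : g ∈ gr 𝒜 S k) : f * g = ((-1 : ℤ) ^ (n * k)) • (g * f) := by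
  induction hf using gr_induction with
  | zero => simp
  | add x y _ _ hx hy => rw [add_mul, mul_add, smul_add, hx, hy]
  | single m i a ha h =>
  induction hg using gr_induction with
  | zero => simp
  | add x y _ _ hx hy => rw [add_mul, mul_add, smul_add, hx, hy]
  | single m' i' a' ha' h' =>
  subst h h'
  rw [mono_mul_mono, mono_mul_mono, signAut_pow_of_mem 𝒜 _ ha', signAut_pow_of_mem 𝒜 _ ha,
    S.mul_comm m m', S.coeff_comm m m', mul_smul_comm, mul_smul_comm, hA ha ha']
  simp only [map_zsmul, smul_smul]
  congr 1
  have h2 : ((-1 : ℤ) ^ (S.deg m' * i)) * (-1) ^ (S.deg m' * i) = 1 := by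
    rw [← mul_pow]; simp
  have e : (-1 : ℤ) ^ ((i + S.deg m) * (i' + S.deg m')) =
      (-1) ^ (i * i') * (-1) ^ (S.deg m' * i) * (-1) ^ (S.deg m * i') *
        (-1) ^ (S.deg m * S.deg m') := by
    rw [← pow_add, ← pow_add, ← pow_add]; congr 1; ring
  rw [e]
  linear_combination (-(-1) ^ (i * i') * (-1) ^ (S.deg m * i') *
    (-1) ^ (S.deg m * S.deg m') * S.coeff m' m) * h2

theorem sq_zero (hA : ∀ {i j : ℕ} {a b : A}, a ∈ 𝒜 i → b ∈ 𝒜 j →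
      a * b = ((-1 : ℤ) ^ (i * j)) • (b * a))
    (hA2 : ∀ {i : ℕ} {a : A}, Odd i → a ∈ 𝒜 i → a * a = 0) {n : ℕ} {f : MonExt 𝒜 S}
    (hn : Odd n) (hf : f ∈ gr 𝒜 S n) : f * f = 0 := by
  induction hf using gr_induction with
  | zero => simp
  | add x y hx hy hxx hyy =>
    have := comm 𝒜 S hA hx hy
    rw [(hn.mul hn).neg_one_pow] at this
    rw [add_mul, mul_add, mul_add, hxx, hyy, this]; simp
  | single m i a ha h =>
    rw [mono_mul_mono, signAut_pow_of_mem 𝒜 _ ha, mul_smul_comm]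
    rcases Nat.even_or_odd i with hi | hi
    · have : Odd (S.deg m) := by
        subst h; rcases Nat.even_or_odd (S.deg m) with h | h
        · exact absurd hn (Nat.not_odd_iff_even.2 (hi.add h))
        · exact h
      rw [S.coeff_self m this, zero_smul]
    · rw [hA2 hi ha]; simp

/-- The inclusion of `A` in `MonExt`. -/
def incl : A →ₐ[R] MonExt 𝒜 S :=
  AlgHom.ofLinearMap (mono 𝒜 S S.one) rfl fun a b => by
    rw [mono_mul_mono, S.deg_one, S.coeff_one_left, S.one_mul]; simp

theorem incl_apply (a : A) : incl 𝒜 S a = mono 𝒜 S S.one a := rfl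

theorem incl_mem {i : ℕ} {a : A} (ha : a ∈ 𝒜 i) : incl 𝒜 S a ∈ gr 𝒜 S i :=
  mono_mem_gr 𝒜 S ha (by simp [S.deg_one])

/-- The monomial `m` as an element of `MonExt`. -/
def basis (m : M) : MonExt 𝒜 S := mono 𝒜 S m 1

theorem basis_one : basis 𝒜 S S.one = 1 := rfl

theorem basis_mem (m : M) : basis 𝒜 S m ∈ gr 𝒜 S (S.deg m) :=
  mono_mem_gr 𝒜 S SetLike.GradedOne.one_mem (by simp)

theorem mono_eq (m : M) (a : A) : mono 𝒜 S m a = incl 𝒜 S a * basis 𝒜 S m := by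
  rw [incl_apply, basis, mono_mul_mono, S.coeff_one_left, S.one_mul]; simp

theorem basis_mul (m n : M) :
    basis 𝒜 S m * basis 𝒜 S n = S.coeff m n • basis 𝒜 S (S.mul m n) := by
  rw [basis, basis, mono_mul_mono]; simp [basis]

/-- The linear extension of the assignment `a m ↦ d(a) m + (-1) ^ |a| a δ(m)`. -/
def dExt (dA : A →ₗ[R] A) (δ : M → MonExt 𝒜 S) : MonExt 𝒜 S →ₗ[R] MonExt 𝒜 S :=
  lift 𝒜 S fun m => mono 𝒜 S m ∘ₗ dA +
    LinearMap.mulRight R (δ m) ∘ₗ (incl 𝒜 S).toLinearMap ∘ₗ (signAut 𝒜).toLinearMap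

theorem dExt_mono (dA : A →ₗ[R] A) (δ : M → MonExt 𝒜 S) {m : M} {i : ℕ} {a : A} (ha : a ∈ 𝒜 i) :
    dExt 𝒜 S dA δ (mono 𝒜 S m a) =
      incl 𝒜 S (dA a) * basis 𝒜 S m + ((-1 : ℤ) ^ i) • (incl 𝒜 S a * δ m) := by
  rw [dExt, lift_mono, ← mono_eq]
  simp [signAut_of_mem 𝒜 ha, mul_assoc]

end MonExt

end MonExt

namespace DGAlgebra

variable {R : Type u} [CommRing R] (A : DGAlgebra.{u, v} R) {M : Type} (S : MonomialSystem M)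

open MonExt

variable {δ : M → MonExt A.gr S}

theorem dExt_basis (m : M) : dExt A.gr S A.d δ (basis A.gr S m) = δ m := by
  have h1 : (1 : A.carrier) ∈ A.gr 0 := SetLike.GradedOne.one_mem
  rw [basis, dExt_mono A.gr S _ _ h1, A.d_gr_zero h1]; simp

theorem dExt_incl (hδ1 : δ S.one = 0) (a : A.carrier) :
    dExt A.gr S A.d δ (incl A.gr S a) = incl A.gr S (A.d a) := by
  rw [incl_apply, dExt, lift_mono]
  simp [hδ1, incl_apply]

theorem dExt_mul (hδ0 : ∀ m, S.deg m = 0 → δ m = 0)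
    (hδdeg : ∀ m n, S.deg m = n + 1 → δ m ∈ MonExt.gr A.gr S n)
    (hδmul : ∀ m n, S.coeff m n • δ (S.mul m n) =
      δ m * basis A.gr S n + ((-1 : ℤ) ^ S.deg m) • (basis A.gr S m * δ n))
    {k : ℕ} {f : MonExt A.gr S} (g : MonExt A.gr S) (hf : f ∈ MonExt.gr A.gr S k) :
    dExt A.gr S A.d δ (f * g) =
      dExt A.gr S A.d δ f * g + ((-1 : ℤ) ^ k) • (f * dExt A.gr S A.d δ g) := by
  induction hf using gr_induction with
  | zero => simp
  | add x y _ _ hx hy => rw [add_mul, map_add, map_add, hx, hy, add_mul, add_mul]; module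
  | single m j a ha h =>
  induction g using hom_induction with
  | zero => simp
  | add x y hx hy => rw [mul_add, map_add, map_add, hx, hy, mul_add, mul_add]; module
  | single n l b hb =>
  subst h
  have c1 : basis A.gr S m * incl A.gr S b =
      ((-1 : ℤ) ^ (S.deg m * l)) • (incl A.gr S b * basis A.gr S m) :=
    MonExt.comm A.gr S A.comm (basis_mem A.gr S m) (incl_mem A.gr S hb)
  have c2 : ((-1 : ℤ) ^ l) • (δ m * incl A.gr S b) =
      ((-1 : ℤ) ^ (S.deg m * l)) • (incl A.gr S b * δ m) := by
    rcases Nat.eq_zero_or_pos (S.deg m) with h | h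
    · rw [hδ0 m h]; simp
    · obtain ⟨n, hn⟩ := Nat.exists_eq_add_of_lt h
      rw [zero_add] at hn
      rw [MonExt.comm A.gr S A.comm (hδdeg m n hn) (incl_mem A.gr S hb), smul_smul, hn, ← pow_add]
      congr 2; ring
  have c3 : ((-1 : ℤ) ^ S.deg m) • (basis A.gr S m * incl A.gr S (A.d b)) =
      ((-1 : ℤ) ^ (S.deg m * l)) • (incl A.gr S (A.d b) * basis A.gr S m) := by
    rcases l with _ | l
    · rw [A.d_gr_zero hb]; simp
    · rw [MonExt.comm A.gr S A.comm (basis_mem A.gr S m) (incl_mem A.gr S (A.d_gr_succ hb)),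
        smul_smul, ← pow_add]
      congr 2; ring
  have hab : a * b ∈ A.gr (j + l) := SetLike.GradedMul.mul_mem ha hb
  have e0 : mono A.gr S m a * mono A.gr S n b =
      ((-1 : ℤ) ^ (S.deg m * l)) • S.coeff m n • mono A.gr S (S.mul m n) (a * b) := by
    rw [mono_mul_mono, signAut_pow_of_mem A.gr _ hb, mul_smul_comm, map_zsmul, smul_comm]
  rw [e0, map_zsmul, map_zsmul, dExt_mono A.gr S _ _ hab, smul_add (S.coeff m n),
    smul_comm (S.coeff m n) ((-1 : ℤ) ^ (j + l)), ← mul_smul_comm (S.coeff m n) _ (δ _), hδmul,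
    ← mul_smul_comm (S.coeff m n), ← basis_mul, A.d_mul b ha, dExt_mono A.gr S _ _ ha,
    dExt_mono A.gr S _ _ hb, mono_eq, mono_eq]
  simp only [map_add, map_mul, map_zsmul]
  have t1 : incl A.gr S (A.d a) * basis A.gr S m * (incl A.gr S b * basis A.gr S n) =
      ((-1 : ℤ) ^ (S.deg m * l)) • (incl A.gr S (A.d a) * incl A.gr S b *
        (basis A.gr S m * basis A.gr S n)) := by
    rw [mul_assoc, ← mul_assoc (basis A.gr S m), c1]
    simp only [smul_mul_assoc, mul_smul_comm, mul_assoc]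
  have t2 : ((-1 : ℤ) ^ l) • (incl A.gr S a * δ m * (incl A.gr S b * basis A.gr S n)) =
      ((-1 : ℤ) ^ (S.deg m * l)) • (incl A.gr S a * incl A.gr S b *
        (δ m * basis A.gr S n)) := by
    rw [mul_assoc, ← mul_assoc (δ m), ← mul_smul_comm, ← smul_mul_assoc, c2]
    simp only [smul_mul_assoc, mul_smul_comm, mul_assoc]
  have t3 : ((-1 : ℤ) ^ S.deg m) • (incl A.gr S a * basis A.gr S m *
        (incl A.gr S (A.d b) * basis A.gr S n)) =
      ((-1 : ℤ) ^ (S.deg m * l)) • (incl A.gr S a * incl A.gr S (A.d b) *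
        (basis A.gr S m * basis A.gr S n)) := by
    rw [mul_assoc, ← mul_assoc (basis A.gr S m), ← mul_smul_comm, ← smul_mul_assoc, c3]
    simp only [smul_mul_assoc, mul_smul_comm, mul_assoc]
  have t4 : incl A.gr S a * basis A.gr S m * (incl A.gr S b * δ n) =
      ((-1 : ℤ) ^ (S.deg m * l)) • (incl A.gr S a * incl A.gr S b *
        (basis A.gr S m * δ n)) := by
    rw [mul_assoc, ← mul_assoc (basis A.gr S m), c1]
    simp only [smul_mul_assoc, mul_smul_comm, mul_assoc]
  have sl : ((-1 : ℤ) ^ l) * (-1) ^ l = 1 := by rw [← mul_pow]; simp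
  have t2' : incl A.gr S a * δ m * (incl A.gr S b * basis A.gr S n) =
      ((-1 : ℤ) ^ l * (-1 : ℤ) ^ (S.deg m * l)) • (incl A.gr S a * incl A.gr S b *
        (δ m * basis A.gr S n)) := by
    rw [mul_smul, ← t2, smul_smul, sl, one_smul]
  simp only [add_mul, mul_add, smul_add, smul_mul_assoc, mul_smul_comm, pow_add, mul_smul]
  rw [t1, t2', t4, t3]
  module

theorem dExt_gr_zero (hδ0 : ∀ m, S.deg m = 0 → δ m = 0) {f : MonExt A.gr S}
    (hf : f ∈ MonExt.gr A.gr S 0) : dExt A.gr S A.d δ f = 0 := by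
  induction hf using gr_induction with
  | zero => simp
  | add x y _ _ hx hy => rw [map_add, hx, hy, add_zero]
  | single m i a ha h =>
    obtain ⟨rfl, hm⟩ : i = 0 ∧ S.deg m = 0 := by omega
    rw [dExt_mono A.gr S _ _ ha, A.d_gr_zero ha, hδ0 m hm]; simp

theorem dExt_gr_succ (hδ0 : ∀ m, S.deg m = 0 → δ m = 0)
    (hδdeg : ∀ m n, S.deg m = n + 1 → δ m ∈ MonExt.gr A.gr S n) {k : ℕ} {f : MonExt A.gr S}
    (hf : f ∈ MonExt.gr A.gr S (k + 1)) : dExt A.gr S A.d δ f ∈ MonExt.gr A.gr S k := by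
  induction hf using gr_induction with
  | zero => simp
  | add x y _ _ hx hy => rw [map_add]; exact add_mem hx hy
  | single m i a ha h =>
    rw [dExt_mono A.gr S _ _ ha]
    refine add_mem ?_ (zsmul_mem ?_ _)
    · rcases i with _ | i
      · rw [A.d_gr_zero ha]; simp
      · have : k = i + S.deg m := by omega
        rw [this]
        exact SetLike.GradedMul.mul_mem (incl_mem A.gr S (A.d_gr_succ ha)) (basis_mem A.gr S m)
    · rcases Nat.eq_zero_or_pos (S.deg m) with h0 | h0
      · rw [hδ0 m h0]; simp
      · obtain ⟨n, hn⟩ := Nat.exists_eq_add_of_lt h0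
        rw [zero_add] at hn
        have : k = i + n := by omega
        rw [this]
        exact SetLike.GradedMul.mul_mem (incl_mem A.gr S ha) (hδdeg m n hn)

theorem dExt_d (hδ0 : ∀ m, S.deg m = 0 → δ m = 0)
    (hδdeg : ∀ m n, S.deg m = n + 1 → δ m ∈ MonExt.gr A.gr S n)
    (hδmul : ∀ m n, S.coeff m n • δ (S.mul m n) =
      δ m * basis A.gr S n + ((-1 : ℤ) ^ S.deg m) • (basis A.gr S m * δ n))
    (hδd : ∀ m, dExt A.gr S A.d δ (δ m) = 0) (f : MonExt A.gr S) :
    dExt A.gr S A.d δ (dExt A.gr S A.d δ f) = 0 := by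
  have hδ1 : δ S.one = 0 := hδ0 _ S.deg_one
  induction f using hom_induction with
  | zero => simp
  | add x y hx hy => rw [map_add, map_add, hx, hy, add_zero]
  | single m i a ha =>
    rw [dExt_mono A.gr S _ _ ha, map_add, map_zsmul,
      dExt_mul A S hδ0 hδdeg hδmul _ (incl_mem A.gr S ha), hδd, dExt_incl A S hδ1]
    rcases i with _ | i
    · rw [A.d_gr_zero ha]; simp
    · rw [dExt_mul A S hδ0 hδdeg hδmul _ (incl_mem A.gr S (A.d_gr_succ ha)),
        dExt_incl A S hδ1, A.d_d, dExt_basis A S]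
      simp [pow_succ]

theorem dExt_dd_mul (hδ0 : ∀ m, S.deg m = 0 → δ m = 0)
    (hδdeg : ∀ m n, S.deg m = n + 1 → δ m ∈ MonExt.gr A.gr S n)
    (hδmul : ∀ m n, S.coeff m n • δ (S.mul m n) =
      δ m * basis A.gr S n + ((-1 : ℤ) ^ S.deg m) • (basis A.gr S m * δ n))
    {k : ℕ} {f g : MonExt A.gr S} (hk : f ∈ MonExt.gr A.gr S k)
    (hf : dExt A.gr S A.d δ (dExt A.gr S A.d δ f) = 0)
    (hg : dExt A.gr S A.d δ (dExt A.gr S A.d δ g) = 0) :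
    dExt A.gr S A.d δ (dExt A.gr S A.d δ (f * g)) = 0 := by
  rw [dExt_mul A S hδ0 hδdeg hδmul _ hk, map_add, map_zsmul,
    dExt_mul A S hδ0 hδdeg hδmul _ hk, hg]
  rcases k with _ | k
  · rw [dExt_gr_zero A S hδ0 hk]; simp
  · rw [dExt_mul A S hδ0 hδdeg hδmul _ (dExt_gr_succ A S hδ0 hδdeg hk), hf]
    simp [pow_succ]

/-- The dg algebra on `MonExt` with `d(a m) = d(a) m + (-1) ^ |a| a δ(m)`, for a map `δ` of degree
`-1` on monomials that obeys the Leibniz rule and has cycles as values. -/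
def monExt (δ : M → MonExt A.gr S) (hδ0 : ∀ m, S.deg m = 0 → δ m = 0)
    (hδdeg : ∀ m n, S.deg m = n + 1 → δ m ∈ MonExt.gr A.gr S n)
    (hδmul : ∀ m n, S.coeff m n • δ (S.mul m n) =
      δ m * basis A.gr S n + ((-1 : ℤ) ^ S.deg m) • (basis A.gr S m * δ n))
    (hδd : ∀ m, dExt A.gr S A.d δ (δ m) = 0) : DGAlgebra.{u, v} R where
  carrier := MonExt A.gr S
  gr := MonExt.gr A.gr S
  comm := MonExt.comm A.gr S A.comm
  sq_zero := MonExt.sq_zero A.gr S A.comm A.sq_zero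
  d := dExt A.gr S A.d δ
  d_gr_zero := dExt_gr_zero A S hδ0
  d_gr_succ := dExt_gr_succ A S hδ0 hδdeg
  d_d := dExt_d A S hδ0 hδdeg hδmul hδd
  d_mul := dExt_mul A S hδ0 hδdeg hδmul


/-- The inclusion of `A`. -/
def monExtIncl (δ : M → MonExt A.gr S) (hδ0 : ∀ m, S.deg m = 0 → δ m = 0)
    (hδdeg : ∀ m n, S.deg m = n + 1 → δ m ∈ MonExt.gr A.gr S n)
    (hδmul : ∀ m n, S.coeff m n • δ (S.mul m n) =
      δ m * basis A.gr S n + ((-1 : ℤ) ^ S.deg m) • (basis A.gr S m * δ n))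
    (hδd : ∀ m, dExt A.gr S A.d δ (δ m) = 0) :
    DGHom A (A.monExt S δ hδ0 hδdeg hδmul hδd) where
  toAlgHom := incl A.gr S
  map_gr := incl_mem A.gr S
  map_d := fun a => (dExt_incl A S (hδ0 _ S.deg_one) a).symm

end DGAlgebra

/-! ### Polynomial, exterior and divided power variables -/

/-- The monomials `x ^ α` in polynomial variables `x_i` of even degrees `deg i`. -/
def polySystem {κ : Type} (deg : κ → ℕ) (hdeg : ∀ i, Even (deg i)) : MonomialSystem (κ →₀ ℕ) where
  one := 0
  mul := fun α β => α + β
  coeff := fun _ _ => 1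
  deg := fun α => Finsupp.weight deg α
  one_mul := zero_add
  mul_one := add_zero
  mul_assoc := add_assoc
  mul_comm := add_comm
  coeff_one_left := fun _ => rfl
  coeff_one_right := fun _ => rfl
  coeff_assoc := fun _ _ _ => rfl
  coeff_comm := fun α β => by
    have h : Even (Finsupp.weight deg α) := by
      rw [Finsupp.weight_apply]
      exact Finset.even_sum _ fun i _ => (hdeg i).mul_left _
    rw [(h.mul_right _).neg_one_pow]; rfl
  coeff_self := fun α h => by
    have h' : Even (Finsupp.weight deg α) := by
      rw [Finsupp.weight_apply]
      exact Finset.even_sum _ fun i _ => (hdeg i).mul_left _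
    exact absurd h (Nat.not_odd_iff_even.2 h')
  deg_one := map_zero _
  deg_mul := fun α β _ => map_add _ α β

/-- The sign of the permutation sorting the concatenation of two disjoint increasing sequences
with underlying sets `F` and `G`; zero if `F` and `G` are not disjoint. -/
def wedgeSign {ι : Type} [LinearOrder ι] (F G : Finset ι) : ℤ :=
  if Disjoint F G then (-1) ^ ((F ×ˢ G).filter fun x => x.2 < x.1).card else 0

section Wedge

variable {ι : Type} [LinearOrder ι]

theorem invCard_union_left {F G : Finset ι} (h : Disjoint F G) (H : Finset ι) :
    (((F ∪ G) ×ˢ H).filter fun x => x.2 < x.1).card =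
      ((F ×ˢ H).filter fun x => x.2 < x.1).card + ((G ×ˢ H).filter fun x => x.2 < x.1).card := by
  rw [Finset.union_product, Finset.filter_union, Finset.card_union_of_disjoint]
  exact Finset.disjoint_filter_filter (Finset.disjoint_product.2 (Or.inl h))

theorem invCard_union_right {G H : Finset ι} (h : Disjoint G H) (F : Finset ι) :
    ((F ×ˢ (G ∪ H)).filter fun x => x.2 < x.1).card =
      ((F ×ˢ G).filter fun x => x.2 < x.1).card + ((F ×ˢ H).filter fun x => x.2 < x.1).card := by
  rw [Finset.product_union, Finset.filter_union, Finset.card_union_of_disjoint]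
  exact Finset.disjoint_filter_filter (Finset.disjoint_product.2 (Or.inr h))

theorem invCard_add_swap {F G : Finset ι} (h : Disjoint F G) :
    ((F ×ˢ G).filter fun x => x.2 < x.1).card + ((G ×ˢ F).filter fun x => x.2 < x.1).card =
      F.card * G.card := by
  have e : ((G ×ˢ F).filter fun x => x.2 < x.1).card =
      ((F ×ˢ G).filter fun x => ¬ x.2 < x.1).card := by
    refine Finset.card_bij' (fun x _ => (x.2, x.1)) (fun x _ => (x.2, x.1)) ?_ ?_ ?_ ?_
    · rintro ⟨a, b⟩ hx
      simp only [Finset.mem_filter, Finset.mem_product] at hx ⊢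
      exact ⟨⟨hx.1.2, hx.1.1⟩, not_lt.2 hx.2.le⟩
    · rintro ⟨a, b⟩ hx
      simp only [Finset.mem_filter, Finset.mem_product] at hx ⊢
      refine ⟨⟨hx.1.2, hx.1.1⟩, lt_of_le_of_ne (not_lt.1 hx.2) ?_⟩
      rintro rfl
      exact Finset.disjoint_left.1 h hx.1.1 hx.1.2
    · intros; rfl
    · intros; rfl
  rw [e, Finset.card_filter_add_card_filter_not, Finset.card_product]

theorem wedgeSign_comm (F G : Finset ι) :
    wedgeSign F G = (-1) ^ (F.card * G.card) * wedgeSign G F := by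
  unfold wedgeSign
  by_cases h : Disjoint F G
  · rw [if_pos h, if_pos h.symm, ← invCard_add_swap h, pow_add, mul_assoc, ← mul_pow]; simp
  · rw [if_neg h, if_neg (fun h' => h h'.symm)]; simp

theorem wedgeSign_assoc (F G H : Finset ι) :
    wedgeSign F G * wedgeSign (F ∪ G) H = wedgeSign G H * wedgeSign F (G ∪ H) := by
  unfold wedgeSign
  by_cases h1 : Disjoint F G <;> by_cases h2 : Disjoint G H <;> by_cases h3 : Disjoint F H <;>
    simp only [Finset.disjoint_union_left, Finset.disjoint_union_right, h1, h2, h3, and_true,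
      and_false, if_true, if_false, mul_zero, zero_mul]
  rw [invCard_union_left h1, invCard_union_right h2, ← pow_add, ← pow_add]
  congr 1; ring

theorem union_erase_self {F : Finset ι} {j : ι} (hj : j ∈ F) : {j} ∪ F.erase j = F := by
  rw [← Finset.insert_eq, Finset.insert_erase hj]

theorem wedgeSign_erase_left {F G : Finset ι} {j : ι} (hj : j ∈ F) (hjG : j ∉ G) :
    wedgeSign F G = (-1) ^ (G.filter fun k => k < j).card * wedgeSign (F.erase j) G := by
  have hd : Disjoint {j} (F.erase j) := by simp
  have e : Disjoint F G ↔ Disjoint (F.erase j) G := by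
    conv_lhs => rw [← union_erase_self hj]
    simp [hjG]
  have c : ((F ×ˢ G).filter fun x => x.2 < x.1).card =
      (G.filter fun k => k < j).card + ((F.erase j ×ˢ G).filter fun x => x.2 < x.1).card := by
    conv_lhs => rw [← union_erase_self hj]
    rw [invCard_union_left hd, Finset.singleton_product, Finset.filter_map, Finset.card_map]
    rfl
  unfold wedgeSign
  by_cases h : Disjoint F G
  · rw [if_pos h, if_pos (e.1 h), c, pow_add]
  · rw [if_neg h, if_neg (fun h' => h (e.2 h')), mul_zero]

theorem wedgeSign_erase_right {F G : Finset ι} {j : ι} (hj : j ∈ G) (hjF : j ∉ F) :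
    wedgeSign F G = (-1) ^ (F.filter fun k => j < k).card * wedgeSign F (G.erase j) := by
  have hd : Disjoint {j} (G.erase j) := by simp
  have e : Disjoint F G ↔ Disjoint F (G.erase j) := by
    conv_lhs => rw [← union_erase_self hj]
    simp [hjF]
  have c : ((F ×ˢ G).filter fun x => x.2 < x.1).card =
      (F.filter fun k => j < k).card + ((F ×ˢ G.erase j).filter fun x => x.2 < x.1).card := by
    conv_lhs => rw [← union_erase_self hj]
    rw [invCard_union_right hd, Finset.product_singleton, Finset.filter_map, Finset.card_map]
    rfl
  unfold wedgeSign
  by_cases h : Disjoint F G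
  · rw [if_pos h, if_pos (e.1 h), c, pow_add]
  · rw [if_neg h, if_neg (fun h' => h (e.2 h')), mul_zero]

theorem card_filter_lt_union {F G : Finset ι} (h : Disjoint F G) (j : ι) :
    ((F ∪ G).filter fun k => k < j).card =
      (F.filter fun k => k < j).card + (G.filter fun k => k < j).card := by
  rw [Finset.filter_union, Finset.card_union_of_disjoint (Finset.disjoint_filter_filter h)]

theorem card_filter_lt_gt (F : Finset ι) (j : ι) :
    (F.filter fun k => k < j).card + (F.filter fun k => j < k).card = (F.erase j).card := by
  rw [← Finset.card_union_of_disjoint]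
  · congr 1
    ext k
    simp only [Finset.mem_union, Finset.mem_filter, Finset.mem_erase, ne_eq]
    constructor
    · rintro (⟨h, h'⟩ | ⟨h, h'⟩)
      · exact ⟨h'.ne, h⟩
      · exact ⟨h'.ne', h⟩
    · rintro ⟨h, h'⟩
      rcases lt_or_gt_of_ne h with h2 | h2
      · exact Or.inl ⟨h', h2⟩
      · exact Or.inr ⟨h', h2⟩
  · exact Finset.disjoint_filter.2 fun k _ h h' => lt_asymm h h'

theorem wedgeSign_leibniz_left {F G : Finset ι} {j : ι} (hj : j ∈ F) (hjG : j ∉ G) :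
    wedgeSign F G * (-1) ^ ((F ∪ G).filter fun k => k < j).card =
      (-1) ^ (F.filter fun k => k < j).card * wedgeSign (F.erase j) G := by
  by_cases h : Disjoint F G
  · rw [card_filter_lt_union h, wedgeSign_erase_left hj hjG, pow_add]
    have : ((-1 : ℤ) ^ (G.filter fun k => k < j).card) *
      (-1) ^ (G.filter fun k => k < j).card = 1 := by rw [← mul_pow]; simp
    linear_combination (wedgeSign (F.erase j) G * (-1) ^ (F.filter fun k => k < j).card) * this
  · have h0 : wedgeSign F G = 0 := if_neg h
    have := wedgeSign_erase_left hj hjG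
    rw [h0] at this
    have h1 : wedgeSign (F.erase j) G = 0 := by
      rcases mul_eq_zero.1 this.symm with h | h
      · exact absurd h (pow_ne_zero _ (by norm_num))
      · exact h
    rw [h0, h1]; simp

theorem wedgeSign_leibniz_right {F G : Finset ι} {j : ι} (hj : j ∈ G) (hjF : j ∉ F) :
    wedgeSign F G * (-1) ^ ((F ∪ G).filter fun k => k < j).card =
      (-1) ^ F.card * ((-1) ^ (G.filter fun k => k < j).card * wedgeSign F (G.erase j)) := by
  by_cases h : Disjoint F G
  · rw [card_filter_lt_union h, wedgeSign_erase_right hj hjF]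
    have := card_filter_lt_gt F j
    rw [Finset.erase_eq_of_notMem hjF] at this
    rw [← this, pow_add, pow_add]
    ring
  · have h0 : wedgeSign F G = 0 := if_neg h
    have := wedgeSign_erase_right hj hjF
    rw [h0] at this
    have h1 : wedgeSign F (G.erase j) = 0 := by
      rcases mul_eq_zero.1 this.symm with h | h
      · exact absurd h (pow_ne_zero _ (by norm_num))
      · exact h
    rw [h0, h1]; simp

theorem wedgeSign_leibniz_both {F G : Finset ι} {j : ι} (hj : j ∈ F) (hjG : j ∈ G) :
    (-1) ^ (F.filter fun k => k < j).card * wedgeSign (F.erase j) G +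
      (-1) ^ F.card * ((-1) ^ (G.filter fun k => k < j).card * wedgeSign F (G.erase j)) = 0 := by
  rw [wedgeSign_erase_right hjG (Finset.notMem_erase j F),
    wedgeSign_erase_left hj (Finset.notMem_erase j G)]
  have e1 : (F.erase j).filter (fun k => j < k) = F.filter fun k => j < k := by
    ext k
    simp only [Finset.mem_filter, Finset.mem_erase]
    exact ⟨fun h => ⟨h.1.2, h.2⟩, fun h => ⟨⟨h.2.ne', h.1⟩, h.2⟩⟩
  have e2 : (G.erase j).filter (fun k => k < j) = G.filter fun k => k < j := by
    ext k
    simp only [Finset.mem_filter, Finset.mem_erase]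
    exact ⟨fun h => ⟨h.1.2, h.2⟩, fun h => ⟨⟨h.2.ne, h.1⟩, h.2⟩⟩
  have e3 := card_filter_lt_gt F j
  have e4 := Finset.card_erase_add_one hj
  have sq : ((-1 : ℤ) ^ (G.filter fun k => k < j).card) *
      (-1) ^ (G.filter fun k => k < j).card = 1 := by rw [← mul_pow]; simp
  rw [e1, e2, ← e4, ← e3, pow_succ, pow_add]
  linear_combination (-(-1) ^ (F.filter fun k => k < j).card *
    (-1) ^ (F.filter fun k => j < k).card * wedgeSign (F.erase j) (G.erase j)) * sq

theorem neg_one_pow_sum_odd (deg : ι → ℕ) (hdeg : ∀ i, Odd (deg i)) (F : Finset ι) :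
    (-1 : ℤ) ^ (∑ i ∈ F, deg i) = (-1) ^ F.card := by
  rw [← Finset.prod_pow_eq_pow_sum, Finset.prod_congr rfl fun i _ => (hdeg i).neg_one_pow,
    Finset.prod_const]

/-- The increasing exterior monomials in variables of odd degrees `deg i`. -/
def extSystem (deg : ι → ℕ) (hdeg : ∀ i, Odd (deg i)) : MonomialSystem (Finset ι) where
  one := ∅
  mul := fun F G => F ∪ G
  coeff := wedgeSign
  deg := fun F => ∑ i ∈ F, deg i
  one_mul := Finset.empty_union
  mul_one := Finset.union_empty
  mul_assoc := Finset.union_assoc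
  mul_comm := Finset.union_comm
  coeff_one_left := fun F => by simp [wedgeSign]
  coeff_one_right := fun F => by simp [wedgeSign]
  coeff_assoc := wedgeSign_assoc
  coeff_comm := fun F G => by
    have h : ((-1 : ℤ) ^ ((∑ i ∈ F, deg i) * ∑ i ∈ G, deg i)) = (-1) ^ (F.card * G.card) := by
      rw [pow_mul, neg_one_pow_sum_odd deg hdeg F, ← pow_mul, mul_comm, pow_mul,
        neg_one_pow_sum_odd deg hdeg G, ← pow_mul, mul_comm]
    rw [h, wedgeSign_comm]
  coeff_self := fun F h => by
    unfold wedgeSign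
    rw [if_neg]
    rw [disjoint_self]
    rintro rfl
    simp at h
  deg_one := rfl
  deg_mul := fun F G h => by
    have : Disjoint F G := by
      by_contra h'
      exact h (if_neg h')
    exact Finset.sum_union this

end Wedge

/-- The divided powers `y^(n)` of a variable `y` of even degree `e`, with
`y^(m) y^(n) = (m + n choose m) y^(m + n)`. -/
def dpSystem (e : ℕ) (he : Even e) : MonomialSystem ℕ where
  one := 0
  mul := fun m n => m + n
  coeff := fun m n => ((m + n).choose m : ℤ)
  deg := fun n => n * e
  one_mul := zero_add
  mul_one := add_zero
  mul_assoc := add_assoc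
  mul_comm := add_comm
  coeff_one_left := fun m => by simp
  coeff_one_right := fun m => by simp
  coeff_assoc := fun l m n => by
    norm_cast
    have h := Nat.choose_mul (n := l + m + n) (k := l + m) (s := l)
      (Nat.le_add_right _ _)
    rw [show l + m + n - l = m + n by omega, Nat.add_sub_cancel_left] at h
    rw [← add_assoc l m n]
    linarith
  coeff_comm := fun m n => by
    rw [((he.mul_left m).mul_right _).neg_one_pow, one_mul, add_comm n m,
      Nat.choose_symm_add]
  coeff_self := fun m h => absurd h (Nat.not_odd_iff_even.2 (he.mul_left m))
  deg_one := zero_mul e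
  deg_mul := fun m n _ => add_mul m n e

namespace DGAlgebra

open MonExt

variable {R : Type u} [CommRing R] (A : DGAlgebra.{u, v} R)

section Even

variable {κ : Type} (deg : κ → ℕ) (hdeg : ∀ i, Even (deg i))

/-- The graded polynomial algebra `A[{x_i}]`. -/
abbrev Poly : Type v := MonExt A.gr (polySystem deg hdeg)

variable {A deg hdeg} in
/-- The differential of the monomial `x ^ α` when `∂ x_i = w_i`. -/
def polyδ (w : κ → A.Poly deg hdeg) (α : κ →₀ ℕ) : A.Poly deg hdeg :=
  α.sum fun i n => n • (basis A.gr (polySystem deg hdeg) (α - Finsupp.single i 1) * w i)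

variable {A deg hdeg} in
/-- The differential of `A[{x_i}]` with `∂ x_i = w_i`. -/
def polyD (w : κ → A.Poly deg hdeg) : A.Poly deg hdeg →ₗ[R] A.Poly deg hdeg :=
  dExt A.gr (polySystem deg hdeg) A.d (polyδ w)

theorem polyδ_deg_zero (w : κ → A.Poly deg hdeg)
    (hw : ∀ i, ∃ n, deg i = n + 1 ∧ w i ∈ MonExt.gr A.gr (polySystem deg hdeg) n)
    (α : κ →₀ ℕ) (h : (polySystem deg hdeg).deg α = 0) : polyδ w α = 0 := by
  refine Finset.sum_eq_zero fun i hi => ?_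
  exfalso
  obtain ⟨n, hn, -⟩ := hw i
  have : deg i ≤ Finsupp.weight deg α := Finsupp.le_weight_of_ne_zero' deg (Finsupp.mem_support_iff.1 hi)
  change Finsupp.weight deg α = 0 at h
  omega

theorem polyδ_mem (w : κ → A.Poly deg hdeg)
    (hw : ∀ i, ∃ n, deg i = n + 1 ∧ w i ∈ MonExt.gr A.gr (polySystem deg hdeg) n)
    (α : κ →₀ ℕ) (n : ℕ) (h : (polySystem deg hdeg).deg α = n + 1) :
    polyδ w α ∈ MonExt.gr A.gr (polySystem deg hdeg) n := by
  refine Submodule.sum_mem _ fun i hi => nsmul_mem ?_ _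
  obtain ⟨k, hk, hwk⟩ := hw i
  have e : Finsupp.single i 1 ≤ α := by
    rw [Finsupp.single_le_iff]; exact Nat.one_le_iff_ne_zero.2 (Finsupp.mem_support_iff.1 hi)
  have h2 : Finsupp.weight deg (α - Finsupp.single i 1) + deg i = Finsupp.weight deg α := by
    conv_rhs => rw [← tsub_add_cancel_of_le e, map_add, Finsupp.weight_single]
    simp
  change Finsupp.weight deg α = n + 1 at h
  have : n = Finsupp.weight deg (α - Finsupp.single i 1) + k := by omega
  rw [this]
  exact SetLike.GradedMul.mul_mem (basis_mem A.gr (polySystem deg hdeg) _) hwk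

theorem polyδ_mul (w : κ → A.Poly deg hdeg)
    (hw : ∀ i, ∃ n, deg i = n + 1 ∧ w i ∈ MonExt.gr A.gr (polySystem deg hdeg) n)
    (α β : κ →₀ ℕ) :
    (polySystem deg hdeg).coeff α β • polyδ w ((polySystem deg hdeg).mul α β) =
      polyδ w α * basis A.gr (polySystem deg hdeg) β +
        ((-1 : ℤ) ^ (polySystem deg hdeg).deg α) •
          (basis A.gr (polySystem deg hdeg) α * polyδ w β) := by
  classical
  have hev : ∀ α, Even ((polySystem deg hdeg).deg α) := fun α => by
    change Even (Finsupp.weight deg α)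
    rw [Finsupp.weight_apply]
    exact Finset.even_sum _ fun i _ => (hdeg i).mul_left _
  rw [(hev α).neg_one_pow, one_smul]
  change (1 : ℤ) • polyδ w (α + β) = _
  rw [one_smul]
  have hs : ∀ γ : κ →₀ ℕ, γ.support ⊆ α.support ∪ β.support → polyδ w γ =
      ∑ i ∈ α.support ∪ β.support,
        γ i • (basis A.gr (polySystem deg hdeg) (γ - Finsupp.single i 1) * w i) := fun γ h =>
    Finsupp.sum_of_support_subset _ h _ (by simp)
  rw [hs (α + β) Finsupp.support_add, hs α Finset.subset_union_left,
    hs β Finset.subset_union_right, Finset.sum_mul, Finset.mul_sum, ← Finset.sum_add_distrib]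
  refine Finset.sum_congr rfl fun i _ => ?_
  have key : ∀ γ γ' : κ →₀ ℕ,
      γ i • basis A.gr (polySystem deg hdeg) (γ + γ' - Finsupp.single i 1) =
      γ i • (basis A.gr (polySystem deg hdeg) (γ - Finsupp.single i 1) *
        basis A.gr (polySystem deg hdeg) γ') := by
    intro γ γ'
    rcases Nat.eq_zero_or_pos (γ i) with h | h
    · rw [h, zero_smul, zero_smul]
    · have e : Finsupp.single i 1 ≤ γ := by rw [Finsupp.single_le_iff]; exact h
      rw [basis_mul]
      change _ = γ i • (1 : ℤ) • basis A.gr (polySystem deg hdeg) (γ - Finsupp.single i 1 + γ')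
      rw [one_smul, tsub_add_eq_add_tsub e]
  have hc : ∀ γ, w i * basis A.gr (polySystem deg hdeg) γ =
      basis A.gr (polySystem deg hdeg) γ * w i := by
    intro γ
    obtain ⟨k, -, hwk⟩ := hw i
    rw [MonExt.comm A.gr _ A.comm hwk (basis_mem A.gr (polySystem deg hdeg) γ),
      ((hev γ).mul_left _).neg_one_pow, one_smul]
  rw [Finsupp.add_apply, add_smul]
  congr 1
  · rw [← smul_mul_assoc, key, smul_mul_assoc, smul_mul_assoc, mul_assoc, mul_assoc, hc]
  · rw [← smul_mul_assoc, add_comm α β, key, smul_mul_assoc, mul_smul_comm, ← mul_assoc]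
    congr 2
    have := MonExt.comm A.gr _ A.comm
      (basis_mem A.gr (polySystem deg hdeg) (β - Finsupp.single i 1))
      (basis_mem A.gr (polySystem deg hdeg) α)
    rw [this, ((hev α).mul_left _).neg_one_pow, one_smul]

theorem polyD_polyδ (w : κ → A.Poly deg hdeg)
    (hw : ∀ i, ∃ n, deg i = n + 1 ∧ w i ∈ MonExt.gr A.gr (polySystem deg hdeg) n)
    (hdw : ∀ i, polyD w (w i) = 0) (α : κ →₀ ℕ) : polyD w (polyδ w α) = 0 := by
  have hd := A.dExt_basis (polySystem deg hdeg) (δ := polyδ w)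
  have h0 := A.polyδ_deg_zero deg hdeg w hw
  have h00 : polyδ w 0 = 0 := h0 0 (map_zero _)
  rw [← hd]
  have hadd : ∀ α β : κ →₀ ℕ,
      polyD w (polyD w (basis A.gr (polySystem deg hdeg) α)) = 0 →
      polyD w (polyD w (basis A.gr (polySystem deg hdeg) β)) = 0 →
      polyD w (polyD w (basis A.gr (polySystem deg hdeg) (α + β))) = 0 := by
    intro α β ha hb
    have e : basis A.gr (polySystem deg hdeg) (α + β) =
        basis A.gr (polySystem deg hdeg) α * basis A.gr (polySystem deg hdeg) β := by
      rw [basis_mul]; exact (one_smul ℤ _).symm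
    rw [e]
    exact dExt_dd_mul A _ h0 (A.polyδ_mem deg hdeg w hw) (A.polyδ_mul deg hdeg w hw)
      (basis_mem A.gr (polySystem deg hdeg) α) ha hb
  change polyD w (polyD w (basis A.gr (polySystem deg hdeg) α)) = 0
  have hz : polyD w (polyD w (basis A.gr (polySystem deg hdeg) 0)) = 0 := by
    have : polyD w (basis A.gr (polySystem deg hdeg) 0) = 0 := by rw [polyD, hd, h00]
    rw [this, map_zero]
  induction α using Finsupp.induction_linear with
  | zero => exact hz
  | add α β ha hb => exact hadd α β ha hb
  | single i n =>
    induction n with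
    | zero => rw [Finsupp.single_zero]; exact hz
    | succ n ih =>
      rw [Finsupp.single_add]
      refine hadd _ _ ih ?_
      have : polyD w (basis A.gr (polySystem deg hdeg) (Finsupp.single i 1)) = w i := by
        rw [polyD, hd, polyδ, Finsupp.sum_single_index (by simp), tsub_self, one_smul]
        exact one_mul _
      rw [this, hdw]

/-- The semifree extension `A[{x_i} | ∂ x_i = w_i]` on polynomial variables of even degree. -/
def adjoinEven (w : κ → A.Poly deg hdeg)
    (hw : ∀ i, ∃ n, deg i = n + 1 ∧ w i ∈ MonExt.gr A.gr (polySystem deg hdeg) n)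
    (hdw : ∀ i, polyD w (w i) = 0) : DGAlgebra.{u, v} R :=
  A.monExt (polySystem deg hdeg) (polyδ w) (A.polyδ_deg_zero deg hdeg w hw)
    (A.polyδ_mem deg hdeg w hw) (A.polyδ_mul deg hdeg w hw) (A.polyD_polyδ deg hdeg w hw hdw)

/-- The inclusion `A → A[{x_i}]`. -/
def adjoinEvenIncl (w : κ → A.Poly deg hdeg)
    (hw : ∀ i, ∃ n, deg i = n + 1 ∧ w i ∈ MonExt.gr A.gr (polySystem deg hdeg) n)
    (hdw : ∀ i, polyD w (w i) = 0) : DGHom A (A.adjoinEven deg hdeg w hw hdw) :=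
  A.monExtIncl (polySystem deg hdeg) (polyδ w) (A.polyδ_deg_zero deg hdeg w hw)
    (A.polyδ_mem deg hdeg w hw) (A.polyδ_mul deg hdeg w hw) (A.polyD_polyδ deg hdeg w hw hdw)

end Even

section Odd

variable {ι : Type} [LinearOrder ι] (deg : ι → ℕ) (hdeg : ∀ i, Odd (deg i))

/-- The differential of the increasing exterior monomial on the set `F` when `∂ x_j = w_j`. -/
def extδ (w : ι → A.carrier) (F : Finset ι) : MonExt A.gr (extSystem deg hdeg) :=
  ∑ j ∈ F, ((-1 : ℤ) ^ (F.filter fun k => k < j).card) •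
    (incl A.gr (extSystem deg hdeg) (w j) * basis A.gr (extSystem deg hdeg) (F.erase j))

theorem extδ_deg_zero (w : ι → A.carrier) (F : Finset ι)
    (h : (extSystem deg hdeg).deg F = 0) : A.extδ deg hdeg w F = 0 := by
  refine Finset.sum_eq_zero fun i hi => ?_
  exfalso
  have := Finset.sum_eq_zero_iff.1 h i hi
  exact (hdeg i).pos.ne' this

theorem extδ_mem (w : ι → A.carrier) (hw : ∀ i, ∃ n, deg i = n + 1 ∧ w i ∈ A.gr n)
    (F : Finset ι) (n : ℕ) (h : (extSystem deg hdeg).deg F = n + 1) :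
    A.extδ deg hdeg w F ∈ MonExt.gr A.gr (extSystem deg hdeg) n := by
  refine Submodule.sum_mem _ fun i hi => zsmul_mem ?_ _
  obtain ⟨k, hk, hwk⟩ := hw i
  have h2 := Finset.sum_erase_add F deg hi
  change ∑ i ∈ F, deg i = n + 1 at h
  have : n = k + ∑ i ∈ F.erase i, deg i := by omega
  rw [this]
  exact SetLike.GradedMul.mul_mem (incl_mem A.gr _ hwk)
    (basis_mem A.gr (extSystem deg hdeg) (F.erase i))

theorem extδ_mul (w : ι → A.carrier) (hw : ∀ i, ∃ n, deg i = n + 1 ∧ w i ∈ A.gr n)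
    (F G : Finset ι) :
    (extSystem deg hdeg).coeff F G • A.extδ deg hdeg w ((extSystem deg hdeg).mul F G) =
      A.extδ deg hdeg w F * basis A.gr (extSystem deg hdeg) G +
        ((-1 : ℤ) ^ (extSystem deg hdeg).deg F) •
          (basis A.gr (extSystem deg hdeg) F * A.extδ deg hdeg w G) := by
  have hs : ((-1 : ℤ) ^ (extSystem deg hdeg).deg F) = (-1) ^ F.card :=
    neg_one_pow_sum_odd deg hdeg F
  have hc : ∀ j, basis A.gr (extSystem deg hdeg) F * incl A.gr _ (w j) =
      incl A.gr _ (w j) * basis A.gr (extSystem deg hdeg) F := by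
    intro j
    obtain ⟨n, hn, hwj⟩ := hw j
    have hn' : Even n := by
      have := hdeg j
      rw [hn] at this
      rcases Nat.even_or_odd n with h | h
      · exact h
      · exact absurd this (Nat.not_odd_iff_even.2 h.add_one)
    rw [MonExt.comm A.gr _ A.comm (basis_mem A.gr (extSystem deg hdeg) F) (incl_mem A.gr _ hwj),
      (hn'.mul_left _).neg_one_pow, one_smul]
  have hb : ∀ F G : Finset ι, basis A.gr (extSystem deg hdeg) F * basis A.gr _ G =
      wedgeSign F G • basis A.gr _ (F ∪ G) := fun F G => basis_mul A.gr _ F G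
  rw [hs]
  change wedgeSign F G • A.extδ deg hdeg w (F ∪ G) = _
  unfold extδ
  rw [Finset.sum_mul, Finset.mul_sum, Finset.smul_sum, Finset.smul_sum,
    Finset.sum_subset_zero_on_sdiff (s₁ := F) (s₂ := F ∪ G)
      (g := fun j => if j ∈ F then ((-1 : ℤ) ^ (F.filter fun k => k < j).card) •
        (incl A.gr (extSystem deg hdeg) (w j) * basis A.gr (extSystem deg hdeg) (F.erase j)) *
          basis A.gr (extSystem deg hdeg) G else 0) Finset.subset_union_left
      (fun j hj => if_neg (Finset.mem_sdiff.1 hj).2) (fun j hj => (if_pos hj).symm),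
    Finset.sum_subset_zero_on_sdiff (s₁ := G) (s₂ := F ∪ G)
      (g := fun j => if j ∈ G then ((-1 : ℤ) ^ F.card) • (basis A.gr (extSystem deg hdeg) F *
        ((-1 : ℤ) ^ (G.filter fun k => k < j).card) •
        (incl A.gr (extSystem deg hdeg) (w j) * basis A.gr (extSystem deg hdeg) (G.erase j)))
        else 0) Finset.subset_union_right
      (fun j hj => if_neg (Finset.mem_sdiff.1 hj).2) (fun j hj => (if_pos hj).symm),
    ← Finset.sum_add_distrib]
  refine Finset.sum_congr rfl fun j hj => ?_
  have t1 : ((-1 : ℤ) ^ (F.filter fun k => k < j).card) •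
        (incl A.gr (extSystem deg hdeg) (w j) * basis A.gr (extSystem deg hdeg) (F.erase j)) *
          basis A.gr (extSystem deg hdeg) G =
      ((-1) ^ (F.filter fun k => k < j).card * wedgeSign (F.erase j) G) •
        (incl A.gr _ (w j) * basis A.gr (extSystem deg hdeg) (F.erase j ∪ G)) := by
    rw [smul_mul_assoc, mul_assoc, hb, mul_smul_comm, smul_smul]
  have t2 : ((-1 : ℤ) ^ F.card) • (basis A.gr (extSystem deg hdeg) F *
        ((-1 : ℤ) ^ (G.filter fun k => k < j).card) •
        (incl A.gr (extSystem deg hdeg) (w j) * basis A.gr (extSystem deg hdeg) (G.erase j))) =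
      ((-1) ^ F.card * ((-1) ^ (G.filter fun k => k < j).card * wedgeSign F (G.erase j))) •
        (incl A.gr _ (w j) * basis A.gr (extSystem deg hdeg) (F ∪ G.erase j)) := by
    rw [mul_smul_comm, ← mul_assoc, hc, mul_assoc, hb, mul_smul_comm, smul_smul, smul_smul,
      mul_assoc ((-1 : ℤ) ^ F.card)]
  rw [t1, t2, smul_smul]
  by_cases hF : j ∈ F <;> by_cases hG : j ∈ G
  · have h0 : wedgeSign F G = 0 := if_neg (Finset.not_disjoint_iff.2 ⟨j, hF, hG⟩)
    have u1 : F.erase j ∪ G = F ∪ G := by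
      ext k; simp only [Finset.mem_union, Finset.mem_erase]
      by_cases hk : k = j
      · subst hk; simp [hG]
      · simp [hk]
    have u2 : F ∪ G.erase j = F ∪ G := by
      ext k; simp only [Finset.mem_union, Finset.mem_erase]
      by_cases hk : k = j
      · subst hk; simp [hF]
      · simp [hk]
    rw [if_pos hF, if_pos hG, u1, u2, ← add_smul, wedgeSign_leibniz_both hF hG, h0]
    simp
  · rw [if_pos hF, if_neg hG, add_zero, wedgeSign_leibniz_left hF hG, Finset.erase_union_distrib,
      Finset.erase_eq_of_notMem hG]
  · rw [if_neg hF, if_pos hG, zero_add, wedgeSign_leibniz_right hG hF, Finset.erase_union_distrib,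
      Finset.erase_eq_of_notMem hF]
  · exact absurd hj (by simp [hF, hG])

theorem dExt_extδ (w : ι → A.carrier) (hw : ∀ i, ∃ n, deg i = n + 1 ∧ w i ∈ A.gr n)
    (hdw : ∀ i, A.d (w i) = 0) (F : Finset ι) :
    dExt A.gr (extSystem deg hdeg) A.d (A.extδ deg hdeg w) (A.extδ deg hdeg w F) = 0 := by
  have hd := A.dExt_basis (extSystem deg hdeg) (δ := A.extδ deg hdeg w)
  have h0 := A.extδ_deg_zero deg hdeg w
  have h00 : A.extδ deg hdeg w ∅ = 0 := rfl
  rw [← hd]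
  induction F using Finset.induction_on with
  | empty => rw [hd, h00, map_zero]
  | insert j F hj ih =>
    have hdj : Disjoint {j} F := Finset.disjoint_singleton_left.2 hj
    have e : basis A.gr (extSystem deg hdeg) {j} * basis A.gr (extSystem deg hdeg) F =
        wedgeSign {j} F • basis A.gr (extSystem deg hdeg) (insert j F) := by
      rw [Finset.insert_eq]; exact basis_mul A.gr (extSystem deg hdeg) {j} F
    have hsq : wedgeSign {j} F * wedgeSign {j} F = 1 := by
      unfold wedgeSign; rw [if_pos hdj, ← mul_pow]; simp
    have e' : basis A.gr (extSystem deg hdeg) (insert j F) =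
        wedgeSign {j} F • (basis A.gr (extSystem deg hdeg) {j} * basis A.gr _ F) := by
      rw [e, smul_smul, hsq, one_smul]
    have h1 : A.extδ deg hdeg w {j} = incl A.gr (extSystem deg hdeg) (w j) := by
      unfold extδ
      rw [Finset.sum_singleton]
      have e1 : Finset.filter (fun k => k < j) {j} = ∅ := by
        rw [Finset.filter_singleton, if_neg (lt_irrefl j)]
      have e2 : ({j} : Finset ι).erase j = ∅ := by simp
      rw [e1, e2]
      simp only [Finset.card_empty, pow_zero, one_smul]
      exact mul_one _
    rw [e', map_zsmul, map_zsmul, dExt_dd_mul A _ h0 (A.extδ_mem deg hdeg w hw)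
      (A.extδ_mul deg hdeg w hw) (basis_mem A.gr (extSystem deg hdeg) {j}) ?_ ih, smul_zero]
    rw [hd, h1, dExt_incl A _ h00, hdw, map_zero]

/-- The semifree extension `A[{x_i} | ∂ x_i = w_i]` on exterior variables of odd degree, for
cycles `w_i` of `A`. -/
def adjoinOdd (w : ι → A.carrier) (hw : ∀ i, ∃ n, deg i = n + 1 ∧ w i ∈ A.gr n)
    (hdw : ∀ i, A.d (w i) = 0) : DGAlgebra.{u, v} R :=
  A.monExt (extSystem deg hdeg) (A.extδ deg hdeg w) (A.extδ_deg_zero deg hdeg w)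
    (A.extδ_mem deg hdeg w hw) (A.extδ_mul deg hdeg w hw) (A.dExt_extδ deg hdeg w hw hdw)

/-- The inclusion `A → A[{x_i}]`. -/
def adjoinOddIncl (w : ι → A.carrier) (hw : ∀ i, ∃ n, deg i = n + 1 ∧ w i ∈ A.gr n)
    (hdw : ∀ i, A.d (w i) = 0) : DGHom A (A.adjoinOdd deg hdeg w hw hdw) :=
  A.monExtIncl (extSystem deg hdeg) (A.extδ deg hdeg w) (A.extδ_deg_zero deg hdeg w)
    (A.extδ_mem deg hdeg w hw) (A.extδ_mul deg hdeg w hw) (A.dExt_extδ deg hdeg w hw hdw)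

end Odd

section DividedPower

variable {k : ℕ} (hk : Odd k) (z : A.carrier)

/-- The differential `∂ (y^(n)) = z y^(n-1)`. -/
def dpδ : ℕ → MonExt A.gr (dpSystem (k + 1) hk.add_one)
  | 0 => 0
  | n + 1 => incl A.gr _ z * basis A.gr _ n

theorem dpδ_deg_zero (n : ℕ) (h : (dpSystem (k + 1) hk.add_one).deg n = 0) :
    A.dpδ hk z n = 0 := by
  rcases n with _ | n
  · rfl
  · exact absurd h (Nat.mul_ne_zero (Nat.succ_ne_zero n) (Nat.succ_ne_zero k))

variable {z}

theorem dpδ_mem (hz : z ∈ A.gr k) (n j : ℕ) (h : (dpSystem (k + 1) hk.add_one).deg n = j + 1) :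
    A.dpδ hk z n ∈ MonExt.gr A.gr (dpSystem (k + 1) hk.add_one) j := by
  rcases n with _ | n
  · exact zero_mem _
  · change (n + 1) * (k + 1) = j + 1 at h
    have : j = k + n * (k + 1) := by nlinarith
    rw [this]
    exact SetLike.GradedMul.mul_mem (incl_mem A.gr _ hz)
      (basis_mem A.gr (dpSystem (k + 1) hk.add_one) n)

theorem dpδ_mul (hz : z ∈ A.gr k) (m n : ℕ) :
    (dpSystem (k + 1) hk.add_one).coeff m n •
        A.dpδ hk z ((dpSystem (k + 1) hk.add_one).mul m n) =
      A.dpδ hk z m * basis A.gr (dpSystem (k + 1) hk.add_one) n +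
        ((-1 : ℤ) ^ (dpSystem (k + 1) hk.add_one).deg m) •
          (basis A.gr (dpSystem (k + 1) hk.add_one) m * A.dpδ hk z n) := by
  have hev : Even (m * (k + 1)) := hk.add_one.mul_left m
  have hs : ((-1 : ℤ) ^ (dpSystem (k + 1) hk.add_one).deg m) = 1 := hev.neg_one_pow
  have hc : basis A.gr (dpSystem (k + 1) hk.add_one) m * incl A.gr _ z =
      incl A.gr _ z * basis A.gr (dpSystem (k + 1) hk.add_one) m := by
    rw [MonExt.comm A.gr _ A.comm (basis_mem A.gr (dpSystem (k + 1) hk.add_one) m)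
      (incl_mem A.gr _ hz)]
    change (-1 : ℤ) ^ (m * (k + 1) * k) • _ = _
    rw [(hev.mul_right k).neg_one_pow, one_smul]
  have hb : ∀ a b : ℕ, basis A.gr (dpSystem (k + 1) hk.add_one) a * basis A.gr _ b =
      ((a + b).choose a : ℤ) • basis A.gr _ (a + b) := fun a b => basis_mul A.gr _ a b
  rw [hs, one_smul]
  change ((m + n).choose m : ℤ) • A.dpδ hk z (m + n) = _
  rcases m with _ | m <;> rcases n with _ | n
  · simp [dpδ]
  · simp only [dpδ, zero_add, Nat.choose_zero_right, Nat.cast_one, one_smul, zero_mul]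
    change incl A.gr _ z * basis A.gr _ (0 + n) = 1 * (incl A.gr _ z * basis A.gr _ n)
    rw [zero_add, one_mul]
  · simp only [dpδ, add_zero, Nat.choose_self, Nat.cast_one, one_smul, mul_zero]
    change incl A.gr _ z * basis A.gr _ m = incl A.gr _ z * basis A.gr _ m * 1
    rw [mul_one]
  · simp only [dpδ]
    rw [← mul_assoc, hc, mul_assoc, mul_assoc, hb, hb]
    change _ • (incl A.gr _ z * basis A.gr _ (m + 1 + n)) = _
    rw [show m + (n + 1) = m + 1 + n by omega, mul_smul_comm, mul_smul_comm, ← add_smul]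
    congr 1

theorem dExt_dpδ (hz : z ∈ A.gr k) (hdz : A.d z = 0) (n : ℕ) :
    dExt A.gr (dpSystem (k + 1) hk.add_one) A.d (A.dpδ hk z) (A.dpδ hk z n) = 0 := by
  rcases n with _ | n
  · exact map_zero _
  · have h := dExt_mul A (dpSystem (k + 1) hk.add_one) (A.dpδ_deg_zero hk z) (A.dpδ_mem hk hz)
      (A.dpδ_mul hk hz) (basis A.gr _ n) (incl_mem A.gr _ hz)
    rw [dExt_incl A _ rfl, hdz, dExt_basis] at h
    change dExt A.gr (dpSystem (k + 1) hk.add_one) A.d (A.dpδ hk z) (_ * _) = 0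
    rw [h]
    rcases n with _ | n
    · simp [dpδ]
    · simp only [dpδ]
      rw [← mul_assoc, ← map_mul, A.sq_zero hk hz]; simp

/-- The divided power extension `A⟨y | ∂ y = z⟩` for a cycle `z` of odd degree `k`. -/
def adjoinDP (hz : z ∈ A.gr k) (hdz : A.d z = 0) : DGAlgebra.{u, v} R :=
  A.monExt (dpSystem (k + 1) hk.add_one) (A.dpδ hk z) (A.dpδ_deg_zero hk z) (A.dpδ_mem hk hz)
    (A.dpδ_mul hk hz) (A.dExt_dpδ hk hz hdz)

/-- The inclusion `A → A⟨y⟩`. -/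
def adjoinDPIncl (hz : z ∈ A.gr k) (hdz : A.d z = 0) : DGHom A (A.adjoinDP hk hz hdz) :=
  A.monExtIncl (dpSystem (k + 1) hk.add_one) (A.dpδ hk z) (A.dpδ_deg_zero hk z)
    (A.dpδ_mem hk hz) (A.dpδ_mul hk hz) (A.dExt_dpδ hk hz hdz)

/-- The divided power `y^(n)` in `A⟨y⟩`. -/
def dpPow (hz : z ∈ A.gr k) (hdz : A.d z = 0) (n : ℕ) : (A.adjoinDP hk hz hdz).carrier :=
  basis A.gr (dpSystem (k + 1) hk.add_one) n

end DividedPower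

/-! ### The semifree extension `A[{x_i, x'_(i+1)}]` -/

section Resolution

/-- The degree of `x_i`, where `z` has degree `k`. -/
def xDeg (p k i : ℕ) : ℕ := (k + 1) * p ^ i

theorem xDeg_even (p : ℕ) {k : ℕ} (hk : Odd k) (i : ℕ) : Even (xDeg p k i) :=
  hk.add_one.mul_right _

variable (p : ℕ) [hp : Fact p.Prime] {k : ℕ} (hk : Odd k) {z : A.carrier}

/-- The element `z x_0^(p-1) ⋯ x_(i-1)^(p-1)`. -/
def xBoundary (z : A.carrier) (i : ℕ) : A.Poly (xDeg p k) (xDeg_even p hk) :=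
  incl A.gr (polySystem (xDeg p k) (xDeg_even p hk)) z *
    basis A.gr (polySystem (xDeg p k) (xDeg_even p hk))
      (∑ j ∈ Finset.range i, Finsupp.single j (p - 1))

theorem xBoundary_deg (i : ℕ) :
    xDeg p k i = k + Finsupp.weight (xDeg p k)
      (∑ j ∈ Finset.range i, Finsupp.single j (p - 1)) + 1 := by
  have h1 : 1 ≤ p := hp.out.one_lt.le
  induction i with
  | zero => simp [xDeg]
  | succ i ih =>
    rw [Finset.sum_range_succ, map_add, Finsupp.weight_single]
    have : xDeg p k (i + 1) = xDeg p k i + (p - 1) * xDeg p k i := by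
      obtain ⟨q, rfl⟩ := Nat.exists_eq_add_of_le h1
      simp only [xDeg, Nat.add_sub_cancel_left]; ring
    rw [this, smul_eq_mul]
    omega

theorem xBoundary_mem (hz : z ∈ A.gr k) (i : ℕ) : ∃ n, xDeg p k i = n + 1 ∧
    A.xBoundary p hk z i ∈ MonExt.gr A.gr (polySystem (xDeg p k) (xDeg_even p hk)) n :=
  ⟨_, xBoundary_deg p i, SetLike.GradedMul.mul_mem (incl_mem A.gr _ hz)
    (basis_mem A.gr (polySystem (xDeg p k) (xDeg_even p hk)) _)⟩

theorem incl_mul_polyδ (hz : z ∈ A.gr k) (α : ℕ →₀ ℕ) :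
    incl A.gr (polySystem (xDeg p k) (xDeg_even p hk)) z * polyδ (A.xBoundary p hk z) α = 0 := by
  rw [polyδ, Finsupp.sum, Finset.mul_sum]
  refine Finset.sum_eq_zero fun i _ => ?_
  rw [xBoundary, mul_smul_comm, ← mul_assoc, ← mul_assoc, MonExt.comm A.gr _ A.comm
    (incl_mem A.gr _ hz) (basis_mem A.gr (polySystem (xDeg p k) (xDeg_even p hk)) _),
    smul_mul_assoc, smul_mul_assoc, mul_assoc (basis _ _ _), ← map_mul, A.sq_zero hk hz]
  simp

theorem xBoundary_cycle (hz : z ∈ A.gr k) (hdz : A.d z = 0) (i : ℕ) :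
    polyD (A.xBoundary p hk z) (A.xBoundary p hk z i) = 0 := by
  have hw := A.xBoundary_mem p hk hz
  have h0 := A.polyδ_deg_zero _ (xDeg_even p hk) _ hw
  conv_lhs => arg 2; rw [xBoundary]
  rw [polyD, dExt_mul A _ h0 (A.polyδ_mem _ (xDeg_even p hk) _ hw)
    (A.polyδ_mul _ (xDeg_even p hk) _ hw) _ (incl_mem A.gr _ hz),
    dExt_incl A _ (h0 0 (map_zero _)), hdz, dExt_basis, A.incl_mul_polyδ p hk hz]
  simp

/-- The dg algebra `A[{x_i}_{i ≥ 0}]` with `∂ x_i = z x_0^(p-1) ⋯ x_(i-1)^(p-1)`. -/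
def xExt (hz : z ∈ A.gr k) (hdz : A.d z = 0) : DGAlgebra.{u, v} R :=
  A.adjoinEven (xDeg p k) (xDeg_even p hk) (A.xBoundary p hk z) (A.xBoundary_mem p hk hz)
    (A.xBoundary_cycle p hk hz hdz)

/-- The variable `x_i` of `A[{x_i}_{i ≥ 0}]`. -/
def xVar (hz : z ∈ A.gr k) (hdz : A.d z = 0) (i : ℕ) : (A.xExt p hk hz hdz).carrier :=
  basis A.gr (polySystem (xDeg p k) (xDeg_even p hk)) (Finsupp.single i 1)

/-- The degree of `x'_(i+1)`. -/
def xDeg' (p k i : ℕ) : ℕ := (k + 1) * p ^ (i + 1) + 1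

theorem xDeg'_odd (p : ℕ) {k : ℕ} (hk : Odd k) (i : ℕ) : Odd (xDeg' p k i) := (xDeg_even p hk (i + 1)).add_one

/-- The element `x_i^p - p x_(i+1)`. -/
def xBoundary' (hz : z ∈ A.gr k) (hdz : A.d z = 0) (i : ℕ) : (A.xExt p hk hz hdz).carrier :=
  A.xVar p hk hz hdz i ^ p - p • A.xVar p hk hz hdz (i + 1)

theorem xVar_pow (hz : z ∈ A.gr k) (hdz : A.d z = 0) (i n : ℕ) :
    A.xVar p hk hz hdz i ^ n =
      basis A.gr (polySystem (xDeg p k) (xDeg_even p hk)) (Finsupp.single i n) := by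
  induction n with
  | zero => rw [Finsupp.single_zero]; exact pow_zero _
  | succ n ih =>
    rw [pow_succ, ih, Finsupp.single_add]
    refine (basis_mul A.gr (polySystem (xDeg p k) (xDeg_even p hk)) _ _).trans ?_
    exact one_smul ℤ _

theorem xVar_mem (hz : z ∈ A.gr k) (hdz : A.d z = 0) (i : ℕ) :
    A.xVar p hk hz hdz i ∈ (A.xExt p hk hz hdz).gr (xDeg p k i) := by
  have h := basis_mem A.gr (polySystem (xDeg p k) (xDeg_even p hk)) (Finsupp.single i 1)
  have e : (polySystem (xDeg p k) (xDeg_even p hk)).deg (Finsupp.single i 1) = xDeg p k i := by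
    change Finsupp.weight _ _ = _
    rw [Finsupp.weight_single, one_smul]
  rw [e] at h
  exact h

theorem xBoundary'_mem (hz : z ∈ A.gr k) (hdz : A.d z = 0) (i : ℕ) :
    ∃ n, xDeg' p k i = n + 1 ∧ A.xBoundary' p hk hz hdz i ∈ (A.xExt p hk hz hdz).gr n := by
  refine ⟨_, rfl, sub_mem ?_ (nsmul_mem (A.xVar_mem p hk hz hdz (i + 1)) p)⟩
  have h := SetLike.pow_mem_graded p (A.xVar_mem p hk hz hdz i)
  have e : p • xDeg p k i = (k + 1) * p ^ (i + 1) := by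
    simp only [xDeg, smul_eq_mul]; ring
  rw [e] at h
  exact h

theorem d_xVar (hz : z ∈ A.gr k) (hdz : A.d z = 0) (i : ℕ) :
    (A.xExt p hk hz hdz).d (A.xVar p hk hz hdz i) = A.xBoundary p hk z i := by
  refine (A.dExt_basis _ _).trans ?_
  rw [polyδ, Finsupp.sum_single_index (by simp), tsub_self, one_smul]
  exact one_mul _

theorem xBoundary'_cycle (hz : z ∈ A.gr k) (hdz : A.d z = 0) (i : ℕ) :
    (A.xExt p hk hz hdz).d (A.xBoundary' p hk hz hdz i) = 0 := by
  rw [xBoundary', map_sub, map_nsmul, d_xVar, xVar_pow]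
  have h : (A.xExt p hk hz hdz).d
      (basis A.gr (polySystem (xDeg p k) (xDeg_even p hk)) (Finsupp.single i p)) =
      p • A.xBoundary p hk z (i + 1) := by
    refine (A.dExt_basis _ _).trans ?_
    rw [polyδ, Finsupp.sum_single_index (by simp), ← Finsupp.single_tsub]
    congr 1
    rw [xBoundary, ← mul_assoc, MonExt.comm A.gr _ A.comm
      (basis_mem A.gr (polySystem (xDeg p k) (xDeg_even p hk)) _) (incl_mem A.gr _ hz)]
    have hev : Even ((polySystem (xDeg p k) (xDeg_even p hk)).deg (Finsupp.single i (p - 1))) := by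
      change Even (Finsupp.weight _ _)
      rw [Finsupp.weight_single]
      exact (xDeg_even p hk i).mul_left _
    rw [(hev.mul_right _).neg_one_pow, one_smul, mul_assoc, basis_mul, xBoundary,
      Finset.sum_range_succ]
    change _ * ((1 : ℤ) • basis A.gr _ (Finsupp.single i (p - 1) +
      ∑ j ∈ Finset.range i, Finsupp.single j (p - 1))) = _
    rw [one_smul, add_comm]
  rw [h]
  exact sub_self _

/-- The semifree extension `A[{x_i, x'_(i+1)}_{i ≥ 0}]` of `A`, with
`∂ x_i = z x_0^(p-1) ⋯ x_(i-1)^(p-1)` and `∂ x'_(i+1) = x_i^p - p x_(i+1)`. -/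
def xxExt (hz : z ∈ A.gr k) (hdz : A.d z = 0) : DGAlgebra.{u, v} R :=
  (A.xExt p hk hz hdz).adjoinOdd (xDeg' p k) (xDeg'_odd p hk) (A.xBoundary' p hk hz hdz)
    (A.xBoundary'_mem p hk hz hdz) (A.xBoundary'_cycle p hk hz hdz)

/-- The inclusion `A[{x_i}] → A[{x_i, x'_(i+1)}]`. -/
def xInclxx (hz : z ∈ A.gr k) (hdz : A.d z = 0) :
    DGHom (A.xExt p hk hz hdz) (A.xxExt p hk hz hdz) :=
  (A.xExt p hk hz hdz).adjoinOddIncl (xDeg' p k) (xDeg'_odd p hk) (A.xBoundary' p hk hz hdz)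
    (A.xBoundary'_mem p hk hz hdz) (A.xBoundary'_cycle p hk hz hdz)

/-- The inclusion `A → A[{x_i, x'_(i+1)}]`. -/
def xxIncl (hz : z ∈ A.gr k) (hdz : A.d z = 0) : DGHom A (A.xxExt p hk hz hdz) :=
  (A.xInclxx p hk hz hdz).comp
    (A.adjoinEvenIncl (xDeg p k) (xDeg_even p hk) (A.xBoundary p hk z) (A.xBoundary_mem p hk hz)
      (A.xBoundary_cycle p hk hz hdz))

/-- The variable `x_i` of `A[{x_i, x'_(i+1)}]`. -/
def xxVar (hz : z ∈ A.gr k) (hdz : A.d z = 0) (i : ℕ) : (A.xxExt p hk hz hdz).carrier :=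
  A.xInclxx p hk hz hdz (A.xVar p hk hz hdz i)

/-- The variable `x'_(i+1)` of `A[{x_i, x'_(i+1)}]`. -/
def xxVar' (hz : z ∈ A.gr k) (hdz : A.d z = 0) (i : ℕ) : (A.xxExt p hk hz hdz).carrier :=
  basis (A.xExt p hk hz hdz).gr (extSystem (xDeg' p k) (xDeg'_odd p hk)) {i}

end Resolution

end DGAlgebra

/-! ### The coefficients -/

/-- The multinomial coefficient of `t p^m` over `p^m, …, p^m` (`t` times). -/
def bCoeff (p t m : ℕ) : ℕ := Nat.multinomial (Finset.range t) fun _ => p ^ m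

/-- The multinomial coefficient of `n` over `n_0, n_1 p, …, n_l p^l`, where `n_0, …, n_l` are the
base `p` digits of `n`. -/
def cCoeff (p n : ℕ) : ℕ :=
  Nat.multinomial (Finset.range (p.digits n).length) fun i => (p.digits n).getD i 0 * p ^ i

/-- `d_i = c_(p^i-1) ∏_(j<i) (b_(p-1,j) c_(p^j-1)^(p-1))^(p^(i-1-j))`. -/
def dCoeff (p i : ℕ) : ℕ :=
  cCoeff p (p ^ i - 1) *
    ∏ j ∈ Finset.range i, (bCoeff p (p - 1) j * cCoeff p (p ^ j - 1) ^ (p - 1)) ^ (p ^ (i - 1 - j))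

end

/-! Write y^(n) = y^n / n! as over the rationals. The integer d_i turns out to be (p^i)! / p^(e_i),
where e_i = 1 + p + ⋯ + p^(i-1) is the exponent of p in (p^i)! (`dCoeff_mul_pow`). Hence x_i goes to
y^(p^i) / p^(e_i) with an honest power of y, and a monomial x^α goes to y^N / p^E, that is, to (N! /
p^E) times the divided power y^(N), where N = ∑ α_i p^i and E = ∑ α_i e_i. Since e_(i+1) = p e_i +
1, the element x_i^p - p x_(i+1) goes to 0. Compatibility with ∂ x_i is the identity `sum_monCoeff`,
which after clearing powers of p reads ∑ α_i p^i (N-1)! = N!.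

Call x^α reduced if every α_i is less than p. Each N is the value of exactly one reduced monomial,
given by the base p digits of N. For it Legendre's formula says that E is the full exponent of p in
N!, so its image is y^(N) times an integer prime to p, which is a unit of R
(`not_dvd_monCoeff_digitExp`, `isUnit_natCast_of_not_dvd`). This gives a linear section s of the
morphism ε, and it remains to show that the kernel of ε is acyclic
(`isQuasiIso_of_surjective_of_acyclic`).

For the kernel, order monomials x^α x'_F by a lexicographic weight. Up to smaller weight the
differential is that of A together with the Koszul rule x'_(j+1) ↦ x_j^p: the terms containing z
lower the first entry of the weight, and the terms p x_(j+1) lower the second. The homotopy h looks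
at the first index i at which a monomial is not reduced, either because α_i is at least p or because
x'_(i+1) occurs; if x'_(i+1) does not occur it trades x_i^p for x'_(i+1), and otherwise it is 0.
Then f - ∂hf - h∂f - sεf has smaller weight than f (`homotopy_mem`). For a cycle f in the kernel
this says that f - ∂hf has smaller weight; it is again a cycle in the kernel because h takes values
there, and well-founded induction on the weight ends the proof. -/

noncomputable section

/-! ### Arithmetic of the coefficients: factorials, powers of p and base p digits. -/

section Coefficients

variable (p : ℕ) [hp : Fact p.Prime]

theorem digits_pow_sub_one (i : ℕ) : p.digits (p ^ i - 1) = List.replicate i (p - 1) := by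
  have h2 := hp.out.two_le
  induction i with
  | zero => simp
  | succ i ih =>
    have h1 : 1 ≤ p ^ i := Nat.one_le_pow _ _ (by omega)
    have e : p ^ (i + 1) - 1 = (p - 1) + p * (p ^ i - 1) := by
      rw [pow_succ', Nat.mul_sub]
      have : p ≤ p * p ^ i := Nat.le_mul_of_pos_right _ h1
      omega
    rw [e, Nat.digits_add p (by omega) _ _ (by omega) (Or.inl (by omega)), ih,
      List.replicate_succ]

/-- All i base p digits of p^i - 1 equal p - 1, so this is the defining property of one multinomial
coefficient. -/
theorem cCoeff_spec (i : ℕ) :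
    cCoeff p (p ^ i - 1) * ∏ j ∈ Finset.range i, ((p - 1) * p ^ j).factorial =
      (p ^ i - 1).factorial := by
  have hs := Nat.multinomial_spec (Finset.range i) fun j => (p - 1) * p ^ j
  have hsum : ∑ j ∈ Finset.range i, (p - 1) * p ^ j = p ^ i - 1 := by
    rw [← Finset.mul_sum, mul_comm, Nat.geomSum_eq hp.out.two_le]
    exact Nat.div_mul_cancel (by simpa using Nat.sub_dvd_pow_sub_pow p 1 i)
  rw [hsum] at hs
  rw [← hs, mul_comm]
  congr 1
  rw [cCoeff, digits_pow_sub_one, List.length_replicate]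
  refine Nat.multinomial_congr fun j hj => ?_
  rw [List.getD_replicate _ (Finset.mem_range.1 hj)]

theorem bCoeff_spec (t m : ℕ) :
    bCoeff p t m * (p ^ m).factorial ^ t = (t * p ^ m).factorial := by
  have hs := Nat.multinomial_spec (Finset.range t) fun _ => p ^ m
  simpa [mul_comm, bCoeff] using hs

/-- Passing from i to i + 1 multiplies the exponents of the old factors by p and adds the factor j =
i with exponent 1. The extra c_(p^i-1) on the left completes c^(p-1) to c^p, so that a p-th power of
d_i can be split off. -/
theorem dCoeff_succ (i : ℕ) :
    cCoeff p (p ^ i - 1) * dCoeff p (i + 1) =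
      cCoeff p (p ^ (i + 1) - 1) * bCoeff p (p - 1) i * dCoeff p i ^ p := by
  have hE : ∏ j ∈ Finset.range (i + 1),
      (bCoeff p (p - 1) j * cCoeff p (p ^ j - 1) ^ (p - 1)) ^ (p ^ (i + 1 - 1 - j)) =
      (∏ j ∈ Finset.range i,
        (bCoeff p (p - 1) j * cCoeff p (p ^ j - 1) ^ (p - 1)) ^ (p ^ (i - 1 - j))) ^ p *
      (bCoeff p (p - 1) i * cCoeff p (p ^ i - 1) ^ (p - 1)) := by
    rw [Finset.prod_range_succ, ← Finset.prod_pow]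
    congr 1
    · refine Finset.prod_congr rfl fun j hj => ?_
      have := Finset.mem_range.1 hj
      rw [← pow_mul, ← pow_succ]
      congr 2; omega
    · simp
  have hc : cCoeff p (p ^ i - 1) * cCoeff p (p ^ i - 1) ^ (p - 1) = cCoeff p (p ^ i - 1) ^ p := by
    rw [← pow_succ', Nat.sub_add_cancel hp.out.one_lt.le]
  rw [dCoeff, dCoeff, hE, mul_pow, ← hc]
  ring

/-- The exponent of `p` in `(p ^ i)!`. -/
def facExp (i : ℕ) : ℕ := ∑ j ∈ Finset.range i, p ^ j

theorem facExp_succ (i : ℕ) : facExp p (i + 1) = p * facExp p i + 1 := by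
  rw [facExp, Finset.sum_range_succ', facExp, Finset.mul_sum]
  simp [pow_succ']

theorem sub_one_mul_facExp (i : ℕ) : (p - 1) * facExp p i + 1 = p ^ i := by
  have h1 : 1 ≤ p ^ i := Nat.one_le_pow _ _ hp.out.pos
  have h : p - 1 ∣ p ^ i - 1 := by simpa using Nat.sub_dvd_pow_sub_pow p 1 i
  rw [facExp, Nat.geomSum_eq hp.out.two_le, mul_comm, Nat.div_mul_cancel h]
  omega

/-- The closed form of d_i, on which everything else rests: x_i is sent to an ordinary power of y
divided by the largest possible power of p. -/
theorem dCoeff_mul_pow (i : ℕ) : dCoeff p i * p ^ facExp p i = (p ^ i).factorial := by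
  induction i with
  | zero => simp [dCoeff, facExp, cCoeff, Nat.multinomial]
  | succ i ih =>
    have hc := cCoeff_spec p i
    have hc' := cCoeff_spec p (i + 1)
    rw [Finset.prod_range_succ] at hc'
    set P := ∏ j ∈ Finset.range i, ((p - 1) * p ^ j).factorial
    have hP : 0 < P := Finset.prod_pos fun j _ => Nat.factorial_pos _
    have hc0 : 0 < cCoeff p (p ^ i - 1) :=
      Nat.pos_of_ne_zero fun h => by
        rw [h, zero_mul] at hc; exact (Nat.factorial_pos _).ne hc
    have hf : ∀ j, p ^ j * (p ^ j - 1).factorial = (p ^ j).factorial := fun j =>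
      Nat.mul_factorial_pred (pow_ne_zero _ hp.out.ne_zero)
    have hb := bCoeff_spec p (p - 1) i
    have hpp : (p ^ i).factorial ^ p = (p ^ i).factorial ^ (p - 1) * (p ^ i).factorial := by
      rw [← pow_succ, Nat.sub_add_cancel hp.out.one_lt.le]
    -- The factor c_(p^i-1) P equals (p^i - 1)!; multiplying by it makes both the recursion for d
    -- and the factorial formula for c_(p^(i+1)-1) applicable.
    refine Nat.eq_of_mul_eq_mul_left (Nat.mul_pos hc0 hP) ?_
    calc cCoeff p (p ^ i - 1) * P * (dCoeff p (i + 1) * p ^ facExp p (i + 1))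
        = (cCoeff p (p ^ i - 1) * dCoeff p (i + 1)) * P * p ^ facExp p (i + 1) := by ring
      _ = cCoeff p (p ^ (i + 1) - 1) * bCoeff p (p - 1) i * (dCoeff p i * p ^ facExp p i) ^ p *
          P * p := by
          rw [dCoeff_succ, facExp_succ, pow_succ p (p * _), mul_comm p (facExp p i), pow_mul,
            mul_pow]; ring
      _ = cCoeff p (p ^ (i + 1) - 1) * (P * (bCoeff p (p - 1) i * (p ^ i).factorial ^ (p - 1))) *
          (p ^ i).factorial * p := by rw [ih, hpp]; ring
      _ = (cCoeff p (p ^ i - 1) * P) * (p ^ (i + 1) * (p ^ (i + 1) - 1).factorial) := by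
          rw [hb, hc', ← hf i, ← hc]; ring
      _ = _ := by rw [hf]

/-- The integer `∑ α_i p ^ i`. -/
def monVal (α : ℕ →₀ ℕ) : ℕ := Finsupp.weight (fun i => p ^ i) α

/-- The exponent `∑ α_i (1 + p + ⋯ + p ^ (i - 1))`. -/
def monExp (α : ℕ →₀ ℕ) : ℕ := Finsupp.weight (facExp p) α

theorem monVal_add (α β : ℕ →₀ ℕ) : monVal p (α + β) = monVal p α + monVal p β := map_add _ _ _

theorem monVal_single (i n : ℕ) : monVal p (Finsupp.single i n) = n * p ^ i :=
  Finsupp.weight_single _ _ _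

theorem monExp_add (α β : ℕ →₀ ℕ) : monExp p (α + β) = monExp p α + monExp p β := map_add _ _ _

theorem monExp_single (i n : ℕ) : monExp p (Finsupp.single i n) = n * facExp p i :=
  Finsupp.weight_single _ _ _

/-- Has the shape of Legendre's formula, with the degree of α in the role of the digit sum. Among
monomials of one value, smaller degree therefore means larger exponent of p. -/
theorem sub_one_mul_monExp (α : ℕ →₀ ℕ) : (p - 1) * monExp p α + α.degree = monVal p α := by
  induction α using Finsupp.induction_linear with
  | zero => simp [monExp, monVal]
  | add α β ha hb => rw [monExp_add, monVal_add, map_add, ← ha, ← hb]; ring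
  | single i n =>
    rw [monExp_single, monVal_single, Finsupp.degree_single, ← sub_one_mul_facExp]; ring

/-- Because a! b! divides (a + b)!, it suffices to treat a single variable, where `dCoeff_mul_pow`
applies. -/
theorem pow_monExp_dvd (α : ℕ →₀ ℕ) : p ^ monExp p α ∣ (monVal p α).factorial := by
  have hadd : ∀ α β : ℕ →₀ ℕ, p ^ monExp p α ∣ (monVal p α).factorial →
      p ^ monExp p β ∣ (monVal p β).factorial →
      p ^ monExp p (α + β) ∣ (monVal p (α + β)).factorial := fun α β ha hb => by
    rw [monExp_add, monVal_add, pow_add]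
    exact (mul_dvd_mul ha hb).trans (Nat.factorial_mul_factorial_dvd_factorial_add _ _)
  induction α using Finsupp.induction_linear with
  | zero => simp [monExp, monVal]
  | add α β ha hb => exact hadd _ _ ha hb
  | single i n =>
    induction n with
    | zero => simp [monExp, monVal]
    | succ n ih =>
      rw [Finsupp.single_add]
      refine hadd _ _ ih ?_
      rw [monExp_single, monVal_single, one_mul, one_mul, ← dCoeff_mul_pow]
      exact dvd_mul_left _ _

/-- The coefficient `e` in `∏ (d_i y ^ (p ^ i)) ^ α_i = e y ^ (∑ α_i p ^ i)` (divided powers). -/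
def monCoeff (α : ℕ →₀ ℕ) : ℕ := (monVal p α).factorial / p ^ monExp p α

theorem monCoeff_mul_pow (α : ℕ →₀ ℕ) :
    monCoeff p α * p ^ monExp p α = (monVal p α).factorial :=
  Nat.div_mul_cancel (pow_monExp_dvd p α)

theorem pow_p_pos (n : ℕ) : 0 < p ^ n := Nat.pow_pos hp.out.pos

/-- The binomial coefficient is the one in y^(m) y^(n), so this is the multiplicativity of the
morphism on polynomial monomials. -/
theorem monCoeff_add (α β : ℕ →₀ ℕ) :
    monCoeff p (α + β) = monCoeff p α * monCoeff p β * (monVal p α + monVal p β).choose (monVal p α) := by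
  refine Nat.eq_of_mul_eq_mul_right (pow_p_pos p (monExp p (α + β))) ?_
  rw [monCoeff_mul_pow, monExp_add, pow_add, monVal_add, ← Nat.add_choose_mul_factorial_mul_factorial,
    ← Nat.choose_symm_add, ← monCoeff_mul_pow, ← monCoeff_mul_pow]
  ring

theorem monCoeff_zero : monCoeff p 0 = 1 := by simp [monCoeff, monExp, monVal]

theorem monCoeff_single_one (i : ℕ) : monCoeff p (Finsupp.single i 1) = dCoeff p i := by
  refine Nat.eq_of_mul_eq_mul_right (pow_p_pos p (monExp p (Finsupp.single i 1))) ?_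
  rw [monCoeff_mul_pow, monExp_single, monVal_single, one_mul, one_mul, dCoeff_mul_pow]

/-- Trading x_i^p for x_(i+1) keeps the value and raises the exponent of p by one. This is what
kills ∂ x'_(i+1). -/
theorem monCoeff_single_p (α : ℕ →₀ ℕ) (i : ℕ) :
    monCoeff p (α + Finsupp.single i p) = p * monCoeff p (α + Finsupp.single (i + 1) 1) := by
  refine Nat.eq_of_mul_eq_mul_right (pow_p_pos p (monExp p (α + Finsupp.single i p))) ?_
  have hv : monVal p (α + Finsupp.single i p) = monVal p (α + Finsupp.single (i + 1) 1) := by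
    rw [monVal_add, monVal_add, monVal_single, monVal_single, pow_succ]; ring
  have hm : monExp p (α + Finsupp.single (i + 1) 1) = monExp p (α + Finsupp.single i p) + 1 := by
    rw [monExp_add, monExp_add, monExp_single, monExp_single, facExp_succ]; ring
  rw [monCoeff_mul_pow, hv, ← monCoeff_mul_pow, hm, pow_succ]; ring

/-- The exponent of `x_0^(p-1) ⋯ x_(i-1)^(p-1)`. -/
def lowExp (i : ℕ) : ℕ →₀ ℕ := ∑ j ∈ Finset.range i, Finsupp.single j (p - 1)

theorem monVal_lowExp (i : ℕ) : monVal p (lowExp p i) + 1 = p ^ i := by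
  induction i with
  | zero => simp [lowExp, monVal]
  | succ i ih =>
    rw [lowExp, Finset.sum_range_succ, monVal_add, monVal_single, add_right_comm]
    change monVal p (lowExp p i) + 1 + _ = _
    rw [ih, Nat.sub_mul, one_mul, pow_succ']
    have : p ^ i ≤ p * p ^ i := Nat.le_mul_of_pos_left _ hp.out.pos
    omega

/-- Each factor x_j^(p-1) contributes p^j - 1, and the i ones subtracted here become the factor p^i
in `sum_monCoeff`. -/
theorem monExp_lowExp (i : ℕ) : monExp p (lowExp p i) + i = facExp p i := by
  induction i with
  | zero => simp [lowExp, monExp, facExp]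
  | succ i ih =>
    have h := sub_one_mul_facExp p i
    rw [lowExp, Finset.sum_range_succ, monExp_add, monExp_single]
    change monExp p (lowExp p i) + _ + _ = _
    have h' : facExp p (i + 1) = facExp p i + p ^ i := Finset.sum_range_succ _ _
    rw [h']
    omega

variable {p} in
theorem monVal_sub_single_add_lowExp {α : ℕ →₀ ℕ} {i : ℕ} (hi : α i ≠ 0) :
    monVal p (α - Finsupp.single i 1 + lowExp p i) + 1 = monVal p α := by
  have e : Finsupp.single i 1 ≤ α := by
    rw [Finsupp.single_le_iff]; exact Nat.one_le_iff_ne_zero.2 hi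
  conv_rhs => rw [← tsub_add_cancel_of_le e]
  rw [monVal_add, monVal_add, monVal_single, one_mul, ← monVal_lowExp]; ring

/-- The chain rule for x^α, read off on coefficients. After multiplication by p^E the summand of x_i
becomes α_i p^i (N-1)!, and the α_i p^i add up to N. -/
theorem sum_monCoeff (α : ℕ →₀ ℕ) (hα : α ≠ 0) :
    α.sum (fun i n => n * monCoeff p (α - Finsupp.single i 1 + lowExp p i)) = monCoeff p α := by
  refine Nat.eq_of_mul_eq_mul_right (pow_p_pos p (monExp p α)) ?_
  obtain ⟨i0, hi0⟩ := Finsupp.ne_iff.1 hα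
  have hv0 := monVal_sub_single_add_lowExp (p := p) hi0
  rw [monCoeff_mul_pow, ← Nat.mul_factorial_pred (by omega), Finsupp.sum, Finset.sum_mul, monVal,
    Finsupp.weight_apply, Finsupp.sum, Finset.sum_mul]
  refine Finset.sum_congr rfl fun i hi => ?_
  have hi := Finsupp.mem_support_iff.1 hi
  have hv := monVal_sub_single_add_lowExp (p := p) hi
  have e : Finsupp.single i 1 ≤ α := by
    rw [Finsupp.single_le_iff]; exact Nat.one_le_iff_ne_zero.2 hi
  have hm : monExp p α = monExp p (α - Finsupp.single i 1 + lowExp p i) + i := by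
    conv_lhs => rw [← tsub_add_cancel_of_le e]
    rw [monExp_add, monExp_add, monExp_single, one_mul, ← monExp_lowExp]; ring
  rw [hm, pow_add, mul_assoc, ← mul_assoc (monCoeff _ _), monCoeff_mul_pow, smul_eq_mul]
  have : monVal p (α - Finsupp.single i 1 + lowExp p i) = monVal p α - 1 := by omega
  rw [this]
  change _ = _ * (monVal p α - 1).factorial
  ring

/-- The exponents of the reduced monomial of value `n`. -/
def digitExp (n : ℕ) : ℕ →₀ ℕ := (p.digits n).toFinsupp

theorem digitExp_apply (n i : ℕ) : digitExp p n i = n / p ^ i % p := by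
  rw [digitExp, List.toFinsupp_apply, Nat.getD_digits _ _ hp.out.two_le]

theorem monVal_digitExp (n : ℕ) : monVal p (digitExp p n) = n := by
  have h : ∀ L : List ℕ, monVal p L.toFinsupp = Nat.ofDigits p L := by
    intro L
    induction L using List.reverseRecOn with
    | nil => simp [monVal]
    | append_singleton L a ih =>
      rw [List.toFinsupp_concat_eq_toFinsupp_add_single, monVal_add, ih, monVal_single,
        Nat.ofDigits_append, Nat.ofDigits_singleton, mul_comm]
  rw [digitExp, h, Nat.ofDigits_digits]

theorem degree_digitExp (n : ℕ) : (digitExp p n).degree = (p.digits n).sum := by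
  rw [digitExp]
  induction p.digits n using List.reverseRecOn with
  | nil => simp
  | append_singleton L a ih =>
    rw [List.toFinsupp_concat_eq_toFinsupp_add_single, map_add, ih, Finsupp.degree_single]
    simp

/-- Uniqueness of base p expansions: a reduced monomial is determined by its value. -/
theorem digitExp_monVal {α : ℕ →₀ ℕ} (hα : ∀ i, α i < p) : digitExp p (monVal p α) = α := by
  have hlow : ∀ i, ∑ j ∈ Finset.range i, α j * p ^ j < p ^ i := fun i => by
    induction i with
    | zero => simp
    | succ i ih =>
      rw [Finset.sum_range_succ, pow_succ']
      have := Nat.mul_le_mul_right (p ^ i) (Nat.succ_le_of_lt (hα i))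
      rw [Nat.succ_mul] at this
      omega
  ext i
  -- The value is split into the part below p^i, the digit at i and a multiple of p^(i+1), so that
  -- division by p^i followed by reduction mod p isolates α_i.
  obtain ⟨q, hq⟩ : ∃ q, monVal p α =
      (∑ j ∈ Finset.range i, α j * p ^ j) + p ^ i * (α i + p * q) := by
    obtain ⟨M, hM⟩ : ∃ M, α.support ⊆ Finset.range (i + 1 + M) :=
      ⟨α.support.sup id, fun j hj => Finset.mem_range.2 (by
        have : j ≤ α.support.sup id := Finset.le_sup (f := id) hj
        omega)⟩
    refine ⟨∑ j ∈ Finset.range M, α (i + 1 + j) * p ^ j, ?_⟩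
    rw [monVal, Finsupp.weight_apply, Finsupp.sum_of_support_subset _ hM _ (by simp),
      Finset.sum_range_add, Finset.sum_range_succ, mul_add, Finset.mul_sum, Finset.mul_sum,
      add_assoc]
    refine congrArg₂ _ rfl (congrArg₂ _ (mul_comm _ _) (Finset.sum_congr rfl fun j _ => ?_))
    rw [smul_eq_mul, pow_add, pow_succ]; ring
  rw [digitExp_apply, hq, Nat.add_mul_div_left _ _ (pow_p_pos p i),
    Nat.div_eq_of_lt (hlow i), zero_add, Nat.add_mul_mod_self_left, Nat.mod_eq_of_lt (hα i)]

/-- For a reduced monomial the degree is the digit sum, so `sub_one_mul_monExp` and Legendre's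
formula force the exponent to be the exact p-adic valuation of n!. -/
theorem not_dvd_monCoeff_digitExp (n : ℕ) : ¬ p ∣ monCoeff p (digitExp p n) := by
  have h1 := sub_one_mul_monExp p (digitExp p n)
  have h2 := sub_one_mul_padicValNat_factorial (p := p) n
  have h3 : (p - 1) ≠ 0 := Nat.sub_ne_zero_of_lt hp.out.one_lt
  have hm := monCoeff_mul_pow p (digitExp p n)
  rw [monVal_digitExp] at h1 hm
  rw [degree_digitExp] at h1
  have h4 : monExp p (digitExp p n) = padicValNat p n.factorial :=
    Nat.eq_of_mul_eq_mul_left (Nat.pos_of_ne_zero h3) (by omega)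
  intro h
  have h5 : p ^ (padicValNat p n.factorial + 1) ∣ n.factorial := by
    rw [← h4, pow_succ']
    conv_rhs => rw [← hm]
    exact mul_dvd_mul_right h _
  exact pow_succ_padicValNat_not_dvd (Nat.factorial_ne_zero n) h5

/-- The exponent of any monomial is at most the p-adic valuation of N!; Legendre's formula turns
this into a lower bound for the degree by the digit sum. -/
theorem degree_digitExp_le (α : ℕ →₀ ℕ) : (digitExp p (monVal p α)).degree ≤ α.degree := by
  have h1 := sub_one_mul_monExp p α
  have h2 := sub_one_mul_padicValNat_factorial (p := p) (monVal p α)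
  have h3 : monExp p α ≤ padicValNat p (monVal p α).factorial :=
    (padicValNat_dvd_iff_le (Nat.factorial_ne_zero _)).1 (pow_monExp_dvd p α)
  have h4 := Nat.mul_le_mul_left (p - 1) h3
  -- Legendre's formula is stated with truncated subtraction; this bound makes the subtraction
  -- exact.
  have h5 := Nat.digit_sum_le p (monVal p α)
  rw [degree_digitExp]
  omega

/-- Trading x_i^p for x_(i+1) keeps the value and lowers the degree by p - 1, and the weak
inequality applies to the result. -/
theorem degree_digitExp_lt {α : ℕ →₀ ℕ} {i : ℕ} (hi : p ≤ α i) :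
    (digitExp p (monVal p α)).degree < α.degree := by
  have e : Finsupp.single i p ≤ α := by rwa [Finsupp.single_le_iff]
  have hd := tsub_add_cancel_of_le e
  set β := α - Finsupp.single i p
  have h := degree_digitExp_le p (β + Finsupp.single (i + 1) 1)
  have hv : monVal p (β + Finsupp.single (i + 1) 1) = monVal p α := by
    rw [← hd, monVal_add, monVal_add, monVal_single, monVal_single, pow_succ]; ring
  rw [hv, map_add, Finsupp.degree_single] at h
  rw [← hd, map_add, Finsupp.degree_single, hd]
  exact h.trans_lt (Nat.add_lt_add_left hp.out.one_lt _)

end Coefficients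

namespace DGAlgebra

open MonExt

variable {R : Type u} [CommRing R] (A : DGAlgebra.{u, v} R) (p : ℕ) [hp : Fact p.Prime] {k : ℕ}
  (hk : Odd k) {z : A.carrier} (hz : z ∈ A.gr k) (hdz : A.d z = 0)

/-! ### Calculus with the elements a y^(n). -/

section DividedPowerExtension

/-- The element `a y^(n)` of `A⟨y⟩`. -/
def dpMono (n : ℕ) : A.carrier →ₗ[R] (A.adjoinDP hk hz hdz).carrier :=
  mono A.gr (dpSystem (k + 1) hk.add_one) n

theorem dpMono_mem {n i : ℕ} {a : A.carrier} (ha : a ∈ A.gr i) :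
    A.dpMono hk hz hdz n a ∈ (A.adjoinDP hk hz hdz).gr (i + n * (k + 1)) :=
  mono_mem_gr A.gr (dpSystem (k + 1) hk.add_one) ha rfl

theorem dpMono_mul {m n j : ℕ} (a : A.carrier) {b : A.carrier} (hb : b ∈ A.gr j) :
    A.dpMono hk hz hdz m a * A.dpMono hk hz hdz n b =
      (m + n).choose m • A.dpMono hk hz hdz (m + n) (a * b) := by
  refine (mono_mul_mono A.gr (dpSystem (k + 1) hk.add_one) m n a b).trans ?_
  rw [signAut_pow_of_mem A.gr _ hb]
  have he : Even ((dpSystem (k + 1) hk.add_one).deg m) := hk.add_one.mul_left m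
  rw [(he.mul_right j).neg_one_pow, one_smul]
  exact natCast_zsmul _ _

theorem d_dpMono_zero (a : A.carrier) :
    (A.adjoinDP hk hz hdz).d (A.dpMono hk hz hdz 0 a) = A.dpMono hk hz hdz 0 (A.d a) :=
  A.dExt_incl (dpSystem (k + 1) hk.add_one) (δ := A.dpδ hk z) rfl a

theorem d_dpMono_succ (n : ℕ) {i : ℕ} {a : A.carrier} (ha : a ∈ A.gr i) :
    (A.adjoinDP hk hz hdz).d (A.dpMono hk hz hdz (n + 1) a) =
      A.dpMono hk hz hdz (n + 1) (A.d a) + ((-1 : ℤ) ^ i) • A.dpMono hk hz hdz n (a * z) := by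
  refine (dExt_mono A.gr (dpSystem (k + 1) hk.add_one) A.d (A.dpδ hk z) ha).trans ?_
  rw [← mono_eq]
  simp only [dpδ]
  rw [← mul_assoc, ← map_mul, ← mono_eq]
  rfl

end DividedPowerExtension

/-! ### Calculus with the elements a x^α x'_F. -/

section Resolution

/-- The element `a x ^ α` of `A[{x_i}]`. -/
def xMono (α : ℕ →₀ ℕ) : A.carrier →ₗ[R] (A.xExt p hk hz hdz).carrier :=
  mono A.gr (polySystem (xDeg p k) (xDeg_even p hk)) α

/-- The element `a x ^ α x'_F` of `A[{x_i, x'_(i+1)}]`. -/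
def xxMono (F : Finset ℕ) (α : ℕ →₀ ℕ) : A.carrier →ₗ[R] (A.xxExt p hk hz hdz).carrier :=
  mono (A.xExt p hk hz hdz).gr (extSystem (xDeg' p k) (xDeg'_odd p hk)) F ∘ₗ
    A.xMono p hk hz hdz α

theorem weight_xDeg (α : ℕ →₀ ℕ) : Finsupp.weight (xDeg p k) α = monVal p α * (k + 1) := by
  rw [monVal, Finsupp.weight_apply, Finsupp.weight_apply, Finsupp.sum, Finsupp.sum, Finset.sum_mul]
  refine Finset.sum_congr rfl fun i _ => ?_
  simp only [xDeg, smul_eq_mul]; ring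

theorem xMono_mem {α : ℕ →₀ ℕ} {i : ℕ} {a : A.carrier} (ha : a ∈ A.gr i) :
    A.xMono p hk hz hdz α a ∈ (A.xExt p hk hz hdz).gr (i + monVal p α * (k + 1)) :=
  mono_mem_gr A.gr (polySystem (xDeg p k) (xDeg_even p hk)) ha
    (congrArg (i + ·) (weight_xDeg p α))

theorem xxMono_mem {F : Finset ℕ} {α : ℕ →₀ ℕ} {i : ℕ} {a : A.carrier} (ha : a ∈ A.gr i) :
    A.xxMono p hk hz hdz F α a ∈
      (A.xxExt p hk hz hdz).gr (i + monVal p α * (k + 1) + ∑ j ∈ F, xDeg' p k j) :=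
  mono_mem_gr (A.xExt p hk hz hdz).gr (extSystem (xDeg' p k) (xDeg'_odd p hk))
    (A.xMono_mem p hk hz hdz ha) rfl

variable {A p hk hz hdz} in
theorem xx_induction {P : (A.xxExt p hk hz hdz).carrier → Prop} (f : (A.xxExt p hk hz hdz).carrier)
    (zero : P 0) (add : ∀ f g, P f → P g → P (f + g))
    (single : ∀ F α i a, a ∈ A.gr i → P (A.xxMono p hk hz hdz F α a)) : P f := by
  refine mono_induction (𝒜 := (A.xExt p hk hz hdz).gr)
    (S := extSystem (xDeg' p k) (xDeg'_odd p hk)) f zero add fun F b => ?_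
  refine hom_induction (𝒜 := A.gr) (S := polySystem (xDeg p k) (xDeg_even p hk))
    (P := fun b => P (mono (A.xExt p hk hz hdz).gr (extSystem (xDeg' p k) (xDeg'_odd p hk)) F b))
    b ?_ ?_ fun α i a ha => single F α i a ha
  · exact (congrArg P (map_zero (mono (A.xExt p hk hz hdz).gr
      (extSystem (xDeg' p k) (xDeg'_odd p hk)) F))).mpr zero
  · intro b c hb hc
    exact (congrArg P (map_add (mono (A.xExt p hk hz hdz).gr
      (extSystem (xDeg' p k) (xDeg'_odd p hk)) F) b c)).mpr (add _ _ hb hc)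

/-- The linear map out of `A[{x_i, x'_(i+1)}]` with prescribed values on the `a x ^ α x'_F`. -/
def xxLift {N : Type*} [AddCommGroup N] [Module R N]
    (φ : Finset ℕ → (ℕ →₀ ℕ) → A.carrier →ₗ[R] N) : (A.xxExt p hk hz hdz).carrier →ₗ[R] N :=
  MonExt.lift (A.xExt p hk hz hdz).gr (extSystem (xDeg' p k) (xDeg'_odd p hk)) fun F =>
    MonExt.lift A.gr (polySystem (xDeg p k) (xDeg_even p hk)) (φ F)

theorem xxLift_xxMono {N : Type*} [AddCommGroup N] [Module R N]
    (φ : Finset ℕ → (ℕ →₀ ℕ) → A.carrier →ₗ[R] N) (F : Finset ℕ) (α : ℕ →₀ ℕ) (a : A.carrier) :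
    A.xxLift p hk hz hdz φ (A.xxMono p hk hz hdz F α a) = φ F α a := by
  refine (lift_mono (A.xExt p hk hz hdz).gr (extSystem (xDeg' p k) (xDeg'_odd p hk)) _ F _).trans ?_
  exact lift_mono A.gr (polySystem (xDeg p k) (xDeg_even p hk)) (φ F) α a

theorem xMono_mul {α β : ℕ →₀ ℕ} {j : ℕ} (a : A.carrier) {b : A.carrier} (hb : b ∈ A.gr j) :
    A.xMono p hk hz hdz α a * A.xMono p hk hz hdz β b = A.xMono p hk hz hdz (α + β) (a * b) := by
  refine (mono_mul_mono A.gr (polySystem (xDeg p k) (xDeg_even p hk)) α β a b).trans ?_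
  have he : Even ((polySystem (xDeg p k) (xDeg_even p hk)).deg α) := by
    change Even (Finsupp.weight _ _)
    rw [weight_xDeg]
    exact hk.add_one.mul_left _
  rw [signAut_pow_of_mem A.gr _ hb, (he.mul_right j).neg_one_pow, one_smul]
  exact one_smul ℤ _

theorem xxMono_mul {F G : Finset ℕ} {α β : ℕ →₀ ℕ} {j : ℕ} (a : A.carrier) {b : A.carrier}
    (hb : b ∈ A.gr j) :
    A.xxMono p hk hz hdz F α a * A.xxMono p hk hz hdz G β b =
      (wedgeSign F G * (-1) ^ ((∑ l ∈ F, xDeg' p k l) * (j + monVal p β * (k + 1)))) •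
        A.xxMono p hk hz hdz (F ∪ G) (α + β) (a * b) := by
  refine (mono_mul_mono (A.xExt p hk hz hdz).gr (extSystem (xDeg' p k) (xDeg'_odd p hk))
    F G _ _).trans ?_
  rw [signAut_pow_of_mem (A.xExt p hk hz hdz).gr _ (A.xMono_mem p hk hz hdz hb), mul_smul_comm,
    A.xMono_mul p hk hz hdz a hb, map_zsmul, smul_smul]
  rfl

theorem d_xMono {α : ℕ →₀ ℕ} {i : ℕ} {a : A.carrier} (ha : a ∈ A.gr i) :
    (A.xExt p hk hz hdz).d (A.xMono p hk hz hdz α a) = A.xMono p hk hz hdz α (A.d a) +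
      ((-1 : ℤ) ^ i) • α.sum fun l n =>
        n • A.xMono p hk hz hdz (α - Finsupp.single l 1 + lowExp p l) (a * z) := by
  refine (dExt_mono A.gr (polySystem (xDeg p k) (xDeg_even p hk)) A.d _ ha).trans ?_
  rw [← mono_eq]
  refine congrArg₂ _ rfl (congrArg _ ?_)
  rw [polyδ, Finsupp.sum, Finset.mul_sum]
  refine Finset.sum_congr rfl fun l _ => ?_
  rw [mul_smul_comm]
  congr 1
  refine (mul_assoc _ _ _).symm.trans ?_
  rw [← mono_eq]
  refine Eq.trans (congrArg _ ?_) (A.xMono_mul p hk hz hdz a hz)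
  exact (mono_eq A.gr (polySystem (xDeg p k) (xDeg_even p hk)) (lowExp p l) z).symm

theorem xBoundary'_eq (j : ℕ) : A.xBoundary' p hk hz hdz j =
    A.xMono p hk hz hdz (Finsupp.single j p) 1 -
      p • A.xMono p hk hz hdz (Finsupp.single (j + 1) 1) 1 := by
  rw [xBoundary', xVar_pow]; rfl

/-- The three groups differentiate a, one x_l and one x'_(j+1). As x^α has even degree, passing it
costs no sign beyond that of a. -/
theorem d_xxMono {F : Finset ℕ} {α : ℕ →₀ ℕ} {i : ℕ} {a : A.carrier} (ha : a ∈ A.gr i) :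
    (A.xxExt p hk hz hdz).d (A.xxMono p hk hz hdz F α a) =
      A.xxMono p hk hz hdz F α (A.d a) +
      ((-1 : ℤ) ^ i) • (α.sum fun l n =>
        n • A.xxMono p hk hz hdz F (α - Finsupp.single l 1 + lowExp p l) (a * z)) +
      ((-1 : ℤ) ^ i) • ∑ j ∈ F, ((-1 : ℤ) ^ (F.filter fun l => l < j).card) •
        (A.xxMono p hk hz hdz (F.erase j) (α + Finsupp.single j p) a -
          p • A.xxMono p hk hz hdz (F.erase j) (α + Finsupp.single (j + 1) 1) a) := by
  refine (dExt_mono (A.xExt p hk hz hdz).gr (extSystem (xDeg' p k) (xDeg'_odd p hk))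
    (A.xExt p hk hz hdz).d _ (A.xMono_mem p hk hz hdz ha)).trans ?_
  rw [← mono_eq, A.d_xMono p hk hz hdz ha, map_add, map_zsmul, Finsupp.sum, map_sum, pow_add,
    (hk.add_one.mul_left (monVal p α)).neg_one_pow, mul_one, extδ, Finset.mul_sum]
  refine congrArg₂ _ (congrArg₂ _ rfl (congrArg _ ?_)) (congrArg _ ?_)
  · refine Finset.sum_congr rfl fun l _ => ?_
    exact map_nsmul _ _ _
  · refine Finset.sum_congr rfl fun j _ => ?_
    have h1 : (1 : A.carrier) ∈ A.gr 0 := SetLike.GradedOne.one_mem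
    rw [mul_smul_comm, ← mul_assoc, ← map_mul, ← mono_eq, xBoundary'_eq, mul_sub, mul_smul_comm,
      A.xMono_mul p hk hz hdz a h1, A.xMono_mul p hk hz hdz a h1, mul_one, map_sub, map_nsmul]
    rfl

end Resolution

/-! ### Existence and uniqueness of the morphism. -/

section Morphism

variable {A p hk hz hdz} in
theorem xx_gr_induction {n : ℕ} {P : (A.xxExt p hk hz hdz).carrier → Prop}
    (zero : P 0) (add : ∀ f g, P f → P g → P (f + g))
    (single : ∀ F α i a, a ∈ A.gr i →
      i + monVal p α * (k + 1) + ∑ j ∈ F, xDeg' p k j = n → P (A.xxMono p hk hz hdz F α a))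
    {f : (A.xxExt p hk hz hdz).carrier} (hf : f ∈ (A.xxExt p hk hz hdz).gr n) : P f := by
  refine gr_induction (𝒜 := (A.xExt p hk hz hdz).gr)
    (S := extSystem (xDeg' p k) (xDeg'_odd p hk)) (P := fun f _ => P f) zero
    (fun f g _ _ => add f g) (fun F m b hb hm => ?_) hf
  refine gr_induction (𝒜 := A.gr) (S := polySystem (xDeg p k) (xDeg_even p hk))
    (P := fun b _ => P (mono (A.xExt p hk hz hdz).gr (extSystem (xDeg' p k) (xDeg'_odd p hk)) F b))
    ?_ ?_ (fun α i a ha hi => ?_) hb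
  · exact (congrArg P (map_zero (mono (A.xExt p hk hz hdz).gr
      (extSystem (xDeg' p k) (xDeg'_odd p hk)) F))).mpr zero
  · intro b c _ _ hb hc
    exact (congrArg P (map_add (mono (A.xExt p hk hz hdz).gr
      (extSystem (xDeg' p k) (xDeg'_odd p hk)) F) b c)).mpr (add _ _ hb hc)
  · refine single F α i a ha ?_
    have hα : (polySystem (xDeg p k) (xDeg_even p hk)).deg α = monVal p α * (k + 1) :=
      weight_xDeg p α
    rw [hα] at hi
    rw [hi]
    exact hm

/-- The linear map with `x_i ↦ d_i y^(p^i)` and `x'_(i+1) ↦ 0`. -/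
def xxEvalLin : (A.xxExt p hk hz hdz).carrier →ₗ[R] (A.adjoinDP hk hz hdz).carrier :=
  A.xxLift p hk hz hdz fun F α =>
    if F = ∅ then monCoeff p α • A.dpMono hk hz hdz (monVal p α) else 0

theorem xxEvalLin_empty (α : ℕ →₀ ℕ) (a : A.carrier) :
    A.xxEvalLin p hk hz hdz (A.xxMono p hk hz hdz ∅ α a) =
      monCoeff p α • A.dpMono hk hz hdz (monVal p α) a := by
  rw [xxEvalLin, xxLift_xxMono, if_pos rfl]; rfl

theorem xxEvalLin_nonempty {F : Finset ℕ} (hF : F ≠ ∅) (α : ℕ →₀ ℕ) (a : A.carrier) :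
    A.xxEvalLin p hk hz hdz (A.xxMono p hk hz hdz F α a) = 0 := by
  rw [xxEvalLin, xxLift_xxMono, if_neg hF]; rfl

theorem xxEvalLin_mul (f g : (A.xxExt p hk hz hdz).carrier) :
    A.xxEvalLin p hk hz hdz (f * g) = A.xxEvalLin p hk hz hdz f * A.xxEvalLin p hk hz hdz g := by
  induction f using xx_induction with
  | zero => simp
  | add x y hx hy => rw [add_mul, map_add, map_add, add_mul, hx, hy]
  | single F α i a ha =>
  induction g using xx_induction with
  | zero => simp
  | add x y hx hy => rw [mul_add, map_add, map_add, mul_add, hx, hy]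
  | single G β j b hb =>
  rw [A.xxMono_mul p hk hz hdz a hb, map_zsmul]
  by_cases hF : F = ∅
  · by_cases hG : G = ∅
    · subst hF hG
      rw [Finset.union_empty, xxEvalLin_empty, xxEvalLin_empty, xxEvalLin_empty, smul_mul_smul_comm,
        A.dpMono_mul hk hz hdz a hb, monVal_add, monCoeff_add, smul_smul]
      simp [wedgeSign]
    · rw [A.xxEvalLin_nonempty p hk hz hdz hG, mul_zero, xxEvalLin_nonempty, smul_zero]
      exact fun h => hG (Finset.union_eq_empty.1 h).2
  · rw [A.xxEvalLin_nonempty p hk hz hdz hF, zero_mul, xxEvalLin_nonempty, smul_zero]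
    exact fun h => hF (Finset.union_eq_empty.1 h).1

theorem xxEvalLin_one : A.xxEvalLin p hk hz hdz 1 = 1 := by
  refine (A.xxEvalLin_empty p hk hz hdz 0 1).trans ?_
  rw [monCoeff_zero, one_smul, monVal, map_zero]
  rfl

theorem xxEvalLin_mem {n : ℕ} {f : (A.xxExt p hk hz hdz).carrier}
    (hf : f ∈ (A.xxExt p hk hz hdz).gr n) :
    A.xxEvalLin p hk hz hdz f ∈ (A.adjoinDP hk hz hdz).gr n := by
  refine xx_gr_induction
    (P := fun f => A.xxEvalLin p hk hz hdz f ∈ (A.adjoinDP hk hz hdz).gr n) ?_ ?_ ?_ hf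
  · rw [map_zero]; exact zero_mem _
  · intro x y hx hy
    rw [map_add]; exact add_mem hx hy
  · intro F α i a ha hi
    by_cases hF : F = ∅
    · subst hF
      rw [xxEvalLin_empty]
      have := A.dpMono_mem hk hz hdz (n := monVal p α) ha
      rw [Finset.sum_empty, add_zero] at hi
      rw [hi] at this
      exact nsmul_mem this _
    · rw [A.xxEvalLin_nonempty p hk hz hdz hF]; exact zero_mem _

/-- Differentiating an x' gives 0 in the target: another x' remains, or else the difference x_j^p -
p x_(j+1) cancels by `monCoeff_single_p`. With no x' present the claim is `sum_monCoeff`. -/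
theorem xxEvalLin_d (f : (A.xxExt p hk hz hdz).carrier) :
    A.xxEvalLin p hk hz hdz ((A.xxExt p hk hz hdz).d f) =
      (A.adjoinDP hk hz hdz).d (A.xxEvalLin p hk hz hdz f) := by
  induction f using xx_induction with
  | zero => simp
  | add x y hx hy => rw [map_add, map_add, map_add, map_add, hx, hy]
  | single F α i a ha =>
  rw [A.d_xxMono p hk hz hdz ha, map_add, map_add, map_zsmul, map_zsmul, Finsupp.sum, map_sum,
    map_sum]
  simp only [map_nsmul, map_zsmul, map_sub]
  have hsum : ∑ j ∈ F, ((-1 : ℤ) ^ (F.filter fun l => l < j).card) •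
      (A.xxEvalLin p hk hz hdz (A.xxMono p hk hz hdz (F.erase j) (α + Finsupp.single j p) a) -
        p • A.xxEvalLin p hk hz hdz
          (A.xxMono p hk hz hdz (F.erase j) (α + Finsupp.single (j + 1) 1) a)) = 0 := by
    refine Finset.sum_eq_zero fun j _ => ?_
    by_cases hF : F.erase j = ∅
    · have hv : monVal p (α + Finsupp.single j p) = monVal p (α + Finsupp.single (j + 1) 1) := by
        rw [monVal_add, monVal_add, monVal_single, monVal_single, pow_succ]; ring
      rw [hF, xxEvalLin_empty, xxEvalLin_empty, monCoeff_single_p, hv, smul_smul, sub_self,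
        smul_zero]
    · rw [A.xxEvalLin_nonempty p hk hz hdz hF, A.xxEvalLin_nonempty p hk hz hdz hF]; simp
  rw [hsum, smul_zero, add_zero]
  by_cases hF : F = ∅
  · subst hF
    simp only [xxEvalLin_empty, map_nsmul]
    -- Value 0 is separate: y^(0) has no predecessor, and `sum_monCoeff` fails for α = 0.
    rcases eq_or_ne α 0 with rfl | hα
    · have hv : monVal p 0 = 0 := map_zero _
      rw [hv, d_dpMono_zero]; simp
    · obtain ⟨i0, hi0⟩ := Finsupp.ne_iff.1 hα
      obtain ⟨n, hn⟩ : ∃ n, monVal p α = n + 1 :=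
        ⟨_, (monVal_sub_single_add_lowExp (p := p) hi0).symm⟩
      rw [hn, A.d_dpMono_succ hk hz hdz n ha, smul_add, smul_comm (monCoeff p α)]
      congr 2
      rw [← sum_monCoeff p α hα, Finsupp.sum, Finset.sum_smul]
      refine Finset.sum_congr rfl fun l hl => ?_
      have hv := monVal_sub_single_add_lowExp (p := p) (Finsupp.mem_support_iff.1 hl)
      have : monVal p (α - Finsupp.single l 1 + lowExp p l) = n := by omega
      rw [this, mul_smul]
  · simp [A.xxEvalLin_nonempty p hk hz hdz hF]

/-- The morphism of dg `A`-algebras with `x_i ↦ d_i y^(p^i)` and `x'_(i+1) ↦ 0`. -/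
def xxEval : DGHom (A.xxExt p hk hz hdz) (A.adjoinDP hk hz hdz) where
  toAlgHom := AlgHom.ofLinearMap (A.xxEvalLin p hk hz hdz) (A.xxEvalLin_one p hk hz hdz)
    (A.xxEvalLin_mul p hk hz hdz)
  map_gr := A.xxEvalLin_mem p hk hz hdz
  map_d := A.xxEvalLin_d p hk hz hdz

theorem xxEval_incl (a : A.carrier) :
    A.xxEval p hk hz hdz (A.xxIncl p hk hz hdz a) = A.adjoinDPIncl hk hz hdz a := by
  refine (A.xxEvalLin_empty p hk hz hdz 0 a).trans ?_
  rw [monCoeff_zero, one_smul, monVal, map_zero]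
  rfl

theorem xxEval_xxVar (i : ℕ) :
    A.xxEval p hk hz hdz (A.xxVar p hk hz hdz i) = dCoeff p i • A.dpPow hk hz hdz (p ^ i) := by
  refine (A.xxEvalLin_empty p hk hz hdz (Finsupp.single i 1) 1).trans ?_
  rw [monCoeff_single_one, monVal_single, one_mul]
  rfl

theorem xxEval_xxVar' (i : ℕ) : A.xxEval p hk hz hdz (A.xxVar' p hk hz hdz i) = 0 :=
  A.xxEvalLin_nonempty p hk hz hdz (Finset.singleton_ne_empty i) 0 1

theorem xxMono_eq_mul (F : Finset ℕ) (α : ℕ →₀ ℕ) (a : A.carrier) :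
    A.xxMono p hk hz hdz F α a = A.xxIncl p hk hz hdz a *
      (A.xxMono p hk hz hdz ∅ α 1 * A.xxMono p hk hz hdz F 0 1) := by
  have h1 : (1 : A.carrier) ∈ A.gr 0 := SetLike.GradedOne.one_mem
  have e : A.xxIncl p hk hz hdz a = A.xxMono p hk hz hdz ∅ 0 a := rfl
  rw [e, A.xxMono_mul p hk hz hdz 1 h1]
  simp only [wedgeSign, Finset.disjoint_empty_left, if_true, Finset.empty_product,
    Finset.filter_empty, Finset.card_empty, pow_zero, one_mul, Finset.sum_empty, zero_mul,
    one_smul, Finset.empty_union, add_zero]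
  rw [A.xxMono_mul p hk hz hdz a h1]
  simp [wedgeSign]

variable {A p hk hz hdz} in
-- A and the variables generate the extension as an algebra; each monomial is factored by
-- `xxMono_eq_mul` and its two parts are built up one variable at a time.
theorem dgHom_ext_xx {B : DGAlgebra.{u, v} R} {f g : DGHom (A.xxExt p hk hz hdz) B}
    (h : ∀ a, f (A.xxIncl p hk hz hdz a) = g (A.xxIncl p hk hz hdz a))
    (hx : ∀ i, f (A.xxVar p hk hz hdz i) = g (A.xxVar p hk hz hdz i))
    (hx' : ∀ i, f (A.xxVar' p hk hz hdz i) = g (A.xxVar' p hk hz hdz i)) : f = g := by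
  have h1 : (1 : A.carrier) ∈ A.gr 0 := SetLike.GradedOne.one_mem
  have hpoly : ∀ α, f (A.xxMono p hk hz hdz ∅ α 1) = g (A.xxMono p hk hz hdz ∅ α 1) := by
    have h0 : f (A.xxMono p hk hz hdz ∅ 0 1) = g (A.xxMono p hk hz hdz ∅ 0 1) := h 1
    have hadd : ∀ α β, f (A.xxMono p hk hz hdz ∅ α 1) = g (A.xxMono p hk hz hdz ∅ α 1) →
        f (A.xxMono p hk hz hdz ∅ β 1) = g (A.xxMono p hk hz hdz ∅ β 1) →
        f (A.xxMono p hk hz hdz ∅ (α + β) 1) = g (A.xxMono p hk hz hdz ∅ (α + β) 1) := by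
      intro α β hα hβ
      have e : A.xxMono p hk hz hdz ∅ (α + β) 1 =
          A.xxMono p hk hz hdz ∅ α 1 * A.xxMono p hk hz hdz ∅ β 1 := by
        rw [A.xxMono_mul p hk hz hdz 1 h1]; simp [wedgeSign]
      rw [e, map_mul, map_mul, hα, hβ]
    intro α
    induction α using Finsupp.induction_linear with
    | zero => exact h0
    | add α β ha hb => exact hadd _ _ ha hb
    | single i n =>
      induction n with
      | zero => rw [Finsupp.single_zero]; exact h0
      | succ n ih => rw [Finsupp.single_add]; exact hadd _ _ ih (hx i)
  have hext : ∀ F, f (A.xxMono p hk hz hdz F 0 1) = g (A.xxMono p hk hz hdz F 0 1) := by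
    intro F
    induction F using Finset.induction_on with
    | empty => exact h 1
    | insert j F hj ih =>
      have hdj : Disjoint {j} F := Finset.disjoint_singleton_left.2 hj
      -- The sign needed to move x'_(j+1) into its place in the increasing product; being a sign it
      -- is its own inverse.
      set ε : ℤ := (-1) ^ ((({j} : Finset ℕ) ×ˢ F).filter fun x => x.2 < x.1).card with hε
      have hw : wedgeSign {j} F = ε := if_pos hdj
      have hsq : ε * ε = 1 := by rw [hε, ← mul_pow]; simp
      have e : A.xxMono p hk hz hdz (insert j F) 0 1 =
          ε • (A.xxMono p hk hz hdz {j} 0 1 * A.xxMono p hk hz hdz F 0 1) := by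
        rw [A.xxMono_mul p hk hz hdz 1 h1, hw, smul_smul]
        have hv : monVal p 0 = 0 := map_zero _
        rw [hv, zero_mul, add_zero, mul_zero, pow_zero, mul_one, hsq, one_smul, add_zero, mul_one]
        rfl
      have hj' : f (A.xxMono p hk hz hdz {j} 0 1) = g (A.xxMono p hk hz hdz {j} 0 1) := hx' j
      rw [e, map_zsmul, map_zsmul, map_mul, map_mul, ih, hj']
  have key : f.toAlgHom = g.toAlgHom := by
    refine AlgHom.ext fun u => ?_
    induction u using xx_induction with
    | zero => simp
    | add x y hx hy => rw [map_add, map_add, hx, hy]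
    | single F α i a ha => rw [xxMono_eq_mul, map_mul, map_mul, map_mul, map_mul, h, hpoly, hext]
  cases f; cases g; cases key; rfl

end Morphism

end DGAlgebra

/-- The long exact homology sequence of 0 → ker f → A → B → 0, done by hand: preimages of cycles and
of boundaries are corrected by elements of the kernel. -/
theorem DGHom.isQuasiIso_of_surjective_of_acyclic {R : Type u} [CommRing R]
    {A B : DGAlgebra.{u, v} R} (f : DGHom A B)
    (hs : ∀ n, ∀ b ∈ B.gr n, ∃ a ∈ A.gr n, f a = b)
    (hK : ∀ n, ∀ u ∈ A.gr n, A.d u = 0 → f u = 0 → ∃ v ∈ A.gr (n + 1), A.d v = u ∧ f v = 0) :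
    f.IsQuasiIso := by
  intro n
  constructor
  · rw [injective_iff_map_eq_zero]
    intro x hx
    obtain ⟨⟨u, hu⟩, rfl⟩ := Submodule.mkQ_surjective _ x
    have hx' := (Submodule.Quotient.mk_eq_zero _).1 hx
    obtain ⟨b, hb, hbu⟩ : f u ∈ B.boundaries n := hx'
    obtain ⟨a, ha, rfl⟩ := hs _ b hb
    have hdu : A.d u = 0 := hu.2
    obtain ⟨v, hv, hdv, -⟩ := hK n (u - A.d a) (sub_mem hu.1 (A.d_gr_succ ha))
      (by rw [map_sub, hdu, A.d_d, sub_zero]) (by rw [map_sub, f.map_d, hbu, sub_self])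
    refine (Submodule.Quotient.mk_eq_zero _).2 ⟨v + a, add_mem hv ha, ?_⟩
    rw [map_add, hdv]
    exact sub_add_cancel u _
  · intro y
    obtain ⟨⟨b, hb⟩, rfl⟩ := Submodule.mkQ_surjective _ y
    obtain ⟨a, ha, hab⟩ := hs n b hb.1
    have hdb : B.d b = 0 := hb.2
    -- The boundary of the lift a is a cycle in the kernel, so subtracting a suitable v makes a a
    -- cycle. In degree 0 the lift already is one.
    obtain ⟨v, hv, hdv, hfv⟩ : ∃ v ∈ A.gr n, A.d v = A.d a ∧ f v = 0 := by
      rcases n with _ | n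
      · exact ⟨0, zero_mem _, by rw [A.d_gr_zero ha, map_zero], map_zero _⟩
      · exact hK n (A.d a) (A.d_gr_succ ha) (A.d_d a) (by rw [f.map_d, hab, hdb])
    refine ⟨Submodule.Quotient.mk ⟨a - v, sub_mem ha hv, ?_⟩, ?_⟩
    · change A.d (a - v) = 0
      rw [map_sub, hdv, sub_self]
    · refine congrArg Submodule.Quotient.mk (Subtype.ext ?_)
      change f (a - v) = b
      rw [map_sub, hfv, hab, sub_zero]

/-- All uses of the hypotheses that R is local and has residue characteristic p pass through this
lemma. -/
theorem isUnit_natCast_of_not_dvd (R : Type u) [CommRing R] [IsLocalRing R] (p : ℕ)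
    [CharP (IsLocalRing.ResidueField R) p] {n : ℕ} (h : ¬ p ∣ n) : IsUnit (n : R) := by
  rw [← IsLocalRing.residue_ne_zero_iff_isUnit, map_natCast]
  exact fun h' => h ((CharP.cast_eq_zero_iff _ p n).1 h')

namespace DGAlgebra

open MonExt

variable {R : Type u} [CommRing R] (A : DGAlgebra.{u, v} R) (p : ℕ) [hp : Fact p.Prime] {k : ℕ}
  (hk : Odd k) {z : A.carrier} (hz : z ∈ A.gr k) (hdz : A.d z = 0)

/-! ### The linear section given by reduced monomials. -/

section Section

/-- The linear map with `a y^(n) ↦ e⁻¹ a x ^ α`, where `x ^ α` is the reduced monomial that is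
mapped to `e y^(n)`. -/
def dpSection : (A.adjoinDP hk hz hdz).carrier →ₗ[R] (A.xxExt p hk hz hdz).carrier :=
  MonExt.lift A.gr (dpSystem (k + 1) hk.add_one) fun n =>
    -- `Ring.inverse` is 0 at non-units, so the map exists over any R; it is a section once these
    -- integers are units.
    Ring.inverse (monCoeff p (digitExp p n) : R) • A.xxMono p hk hz hdz ∅ (digitExp p n)

theorem dpSection_dpMono (n : ℕ) (a : A.carrier) :
    A.dpSection p hk hz hdz (A.dpMono hk hz hdz n a) =
      Ring.inverse (monCoeff p (digitExp p n) : R) •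
        A.xxMono p hk hz hdz ∅ (digitExp p n) a :=
  lift_mono A.gr (dpSystem (k + 1) hk.add_one) _ n a

theorem dpSection_mem {n : ℕ} {f : (A.adjoinDP hk hz hdz).carrier}
    (hf : f ∈ (A.adjoinDP hk hz hdz).gr n) :
    A.dpSection p hk hz hdz f ∈ (A.xxExt p hk hz hdz).gr n := by
  refine gr_induction (𝒜 := A.gr) (S := dpSystem (k + 1) hk.add_one)
    (P := fun f _ => A.dpSection p hk hz hdz f ∈ (A.xxExt p hk hz hdz).gr n) ?_ ?_ ?_ hf
  · exact (congrArg (· ∈ (A.xxExt p hk hz hdz).gr n) (map_zero _)).mpr (zero_mem _)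
  · intro f g _ _ hf hg
    exact (congrArg (· ∈ (A.xxExt p hk hz hdz).gr n) (map_add _ _ _)).mpr (add_mem hf hg)
  · intro m i a ha hi
    have e := A.dpSection_dpMono p hk hz hdz m a
    have h := A.xxMono_mem p hk hz hdz (F := ∅) (α := digitExp p m) ha
    rw [Finset.sum_empty, add_zero, monVal_digitExp] at h
    have hi' : i + m * (k + 1) = n := hi
    rw [hi'] at h
    exact (congrArg (· ∈ (A.xxExt p hk hz hdz).gr n) e).mpr (Submodule.smul_mem _ _ h)

variable [IsLocalRing R] [CharP (IsLocalRing.ResidueField R) p]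

theorem xxEvalLin_dpSection (f : (A.adjoinDP hk hz hdz).carrier) :
    A.xxEvalLin p hk hz hdz (A.dpSection p hk hz hdz f) = f := by
  have key : A.xxEvalLin p hk hz hdz ∘ₗ A.dpSection p hk hz hdz = LinearMap.id := by
    refine lin_ext (𝒜 := A.gr) (S := dpSystem (k + 1) hk.add_one) fun n a => ?_
    refine (congrArg (A.xxEvalLin p hk hz hdz) (A.dpSection_dpMono p hk hz hdz n a)).trans ?_
    rw [map_smul, xxEvalLin_empty, monVal_digitExp, ← Nat.cast_smul_eq_nsmul R, smul_smul,
      Ring.inverse_mul_cancel _ (isUnit_natCast_of_not_dvd R p (not_dvd_monCoeff_digitExp p n)),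
      one_smul]
    rfl
  exact LinearMap.congr_fun key f

end Section

/-! ### The contracting homotopy and the weight filtration. -/

section Homotopy

/-- The variable `x'_(i+1)` is the first one at which a monomial differs from a reduced one, and
it does not occur in that monomial. -/
def IsPush (F : Finset ℕ) (α : ℕ →₀ ℕ) (i : ℕ) : Prop :=
  p ≤ α i ∧ i ∉ F ∧ ∀ j < i, α j < p ∧ j ∉ F

variable {p} in
theorem IsPush.unique {F : Finset ℕ} {α : ℕ →₀ ℕ} {i j : ℕ} (hi : IsPush p F α i)
    (hj : IsPush p F α j) : i = j := by
  rcases lt_trichotomy i j with h | h | h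
  · exact absurd (hj.2.2 i h).1 (not_lt.2 hi.1)
  · exact h
  · exact absurd (hi.2.2 j h).1 (not_lt.2 hj.1)

open Classical in
/-- The contracting homotopy, which replaces `x_i ^ p` by `x'_(i+1)` for the first possible `i`. -/
def xxHtpy : (A.xxExt p hk hz hdz).carrier →ₗ[R] (A.xxExt p hk hz hdz).carrier :=
  A.xxLift p hk hz hdz fun F α =>
    if h : ∃ i, IsPush p F α i then
      -- The sign (-1)^|a| cancels the one that ∂ acquires in passing a on its way to the new x'.
      A.xxMono p hk hz hdz (insert h.choose F) (α - Finsupp.single h.choose p) ∘ₗ signLin A.gr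
    else 0

variable {p} in
theorem xxHtpy_of_isPush {F : Finset ℕ} {α : ℕ →₀ ℕ} {i : ℕ} (h : IsPush p F α i) {n : ℕ}
    {a : A.carrier} (ha : a ∈ A.gr n) :
    A.xxHtpy p hk hz hdz (A.xxMono p hk hz hdz F α a) =
      ((-1 : ℤ) ^ n) • A.xxMono p hk hz hdz (insert i F) (α - Finsupp.single i p) a := by
  have hex : ∃ i, IsPush p F α i := ⟨i, h⟩
  rw [xxHtpy, xxLift_xxMono, dif_pos hex, hex.choose_spec.unique h, LinearMap.comp_apply,
    signLin_of_mem A.gr ha, map_zsmul]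

variable {p} in
theorem xxHtpy_of_forall_not {F : Finset ℕ} {α : ℕ →₀ ℕ} (h : ∀ i, ¬ IsPush p F α i)
    (a : A.carrier) : A.xxHtpy p hk hz hdz (A.xxMono p hk hz hdz F α a) = 0 := by
  rw [xxHtpy, xxLift_xxMono, dif_neg (by simpa using h)]; rfl

theorem xxEvalLin_xxHtpy (f : (A.xxExt p hk hz hdz).carrier) :
    A.xxEvalLin p hk hz hdz (A.xxHtpy p hk hz hdz f) = 0 := by
  induction f using xx_induction with
  | zero => simp
  | add x y hx hy => rw [map_add, map_add, hx, hy, add_zero]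
  | single F α n a ha =>
    by_cases h : ∃ i, IsPush p F α i
    · obtain ⟨i, hi⟩ := h
      rw [A.xxHtpy_of_isPush hk hz hdz hi ha, map_zsmul,
        A.xxEvalLin_nonempty p hk hz hdz (Finset.insert_ne_empty i F), smul_zero]
    · rw [A.xxHtpy_of_forall_not hk hz hdz (by simpa using h), map_zero]

theorem xxHtpy_mem {n : ℕ} {f : (A.xxExt p hk hz hdz).carrier}
    (hf : f ∈ (A.xxExt p hk hz hdz).gr n) :
    A.xxHtpy p hk hz hdz f ∈ (A.xxExt p hk hz hdz).gr (n + 1) := by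
  refine xx_gr_induction
    (P := fun f => A.xxHtpy p hk hz hdz f ∈ (A.xxExt p hk hz hdz).gr (n + 1)) ?_ ?_ ?_ hf
  · rw [map_zero]; exact zero_mem _
  · intro x y hx hy
    rw [map_add]; exact add_mem hx hy
  · intro F α j a ha hj
    by_cases h : ∃ i, IsPush p F α i
    · obtain ⟨i, hi⟩ := h
      rw [A.xxHtpy_of_isPush hk hz hdz hi ha]
      have hm := A.xxMono_mem p hk hz hdz (F := insert i F) (α := α - Finsupp.single i p) ha
      have e : Finsupp.single i p ≤ α := by rw [Finsupp.single_le_iff]; exact hi.1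
      have hv : monVal p α = monVal p (α - Finsupp.single i p) + p * p ^ i := by
        conv_lhs => rw [← tsub_add_cancel_of_le e, monVal_add, monVal_single]
      have hd : j + monVal p (α - Finsupp.single i p) * (k + 1) +
          ∑ l ∈ insert i F, xDeg' p k l = n + 1 := by
        rw [Finset.sum_insert hi.2.1, ← hj, hv, xDeg', pow_succ]; ring
      rw [hd] at hm
      exact zsmul_mem hm _
    · rw [A.xxHtpy_of_forall_not hk hz hdz (by simpa using h)]; exact zero_mem _

/-- The weight of the monomial `x ^ α x'_F`, with values in `ℕ × ℕ` ordered lexicographically. -/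
def xxWt (F : Finset ℕ) (α : ℕ →₀ ℕ) : ℕ ×ₗ ℕ :=
  -- Here x_i weighs (p^i, 1) and x'_(i+1) weighs (p^(i+1), p), the same as x_i^p, so that the
  -- homotopy preserves weight.
  toLex (monVal p α + ∑ j ∈ F, p ^ (j + 1), α.degree + p * F.card)

variable {p} in
theorem xxWt_push {F : Finset ℕ} {α : ℕ →₀ ℕ} {i : ℕ} (hi : i ∉ F) (hα : p ≤ α i) :
    xxWt p (insert i F) (α - Finsupp.single i p) = xxWt p F α := by
  have e : Finsupp.single i p ≤ α := by rwa [Finsupp.single_le_iff]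
  have hd := tsub_add_cancel_of_le e
  set β := α - Finsupp.single i p
  rw [← hd, xxWt, xxWt, Finset.sum_insert hi, Finset.card_insert_of_notMem hi, monVal_add,
    monVal_single, map_add, Finsupp.degree_single, pow_succ]
  congr 2 <;> ring

variable {p} in
-- The first entry is unchanged and the second drops by p - 1: the term p x_(j+1) of ∂ x'_(j+1) is
-- negligible.
theorem xxWt_erase_lt {F : Finset ℕ} (α : ℕ →₀ ℕ) {j : ℕ} (hj : j ∈ F) :
    xxWt p (F.erase j) (α + Finsupp.single (j + 1) 1) < xxWt p F α := by
  rw [xxWt, xxWt, Prod.Lex.toLex_lt_toLex, monVal_add, monVal_single, map_add,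
    Finsupp.degree_single, ← Finset.add_sum_erase F _ hj, ← Finset.card_erase_add_one hj]
  right
  refine ⟨by ring, ?_⟩
  have := hp.out.one_lt
  simp only [mul_add, mul_one]
  omega

variable {p} in
-- The first entry drops by one: the terms coming from ∂ x_l, in which z appears, are negligible.
theorem xxWt_lowExp_lt (F : Finset ℕ) {α : ℕ →₀ ℕ} {l : ℕ} (hl : α l ≠ 0) :
    xxWt p F (α - Finsupp.single l 1 + lowExp p l) < xxWt p F α := by
  rw [xxWt, xxWt, Prod.Lex.toLex_lt_toLex, ← monVal_sub_single_add_lowExp (p := p) hl]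
  left
  simp only
  omega

variable {p} in
theorem xxWt_digitExp_lt {α : ℕ →₀ ℕ} {i : ℕ} (hi : p ≤ α i) :
    xxWt p ∅ (digitExp p (monVal p α)) < xxWt p ∅ α := by
  rw [xxWt, xxWt, Prod.Lex.toLex_lt_toLex, monVal_digitExp]
  right
  exact ⟨rfl, Nat.add_lt_add_right (degree_digitExp_lt p hi) _⟩

/-- The span of the `a x ^ α x'_F` of weight less than `t`. -/
def xxFil (t : ℕ ×ₗ ℕ) : Submodule R (A.xxExt p hk hz hdz).carrier :=
  Submodule.span R {f | ∃ F α i, ∃ a ∈ A.gr i, xxWt p F α < t ∧ A.xxMono p hk hz hdz F α a = f}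

theorem xxMono_mem_xxFil {t : ℕ ×ₗ ℕ} {F : Finset ℕ} {α : ℕ →₀ ℕ} {i : ℕ} {a : A.carrier}
    (ha : a ∈ A.gr i) (h : xxWt p F α < t) :
    A.xxMono p hk hz hdz F α a ∈ A.xxFil p hk hz hdz t :=
  Submodule.subset_span ⟨F, α, i, a, ha, h, rfl⟩

theorem xxFil_mono {s t : ℕ ×ₗ ℕ} (h : s ≤ t) : A.xxFil p hk hz hdz s ≤ A.xxFil p hk hz hdz t :=
  Submodule.span_mono fun _ ⟨F, α, i, a, ha, hw, e⟩ => ⟨F, α, i, a, ha, hw.trans_le h, e⟩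

theorem exists_mem_xxFil (f : (A.xxExt p hk hz hdz).carrier) :
    ∃ t, f ∈ A.xxFil p hk hz hdz t := by
  induction f using xx_induction with
  | zero => exact ⟨0, zero_mem _⟩
  | add x y hx hy =>
    obtain ⟨s, hs⟩ := hx
    obtain ⟨t, ht⟩ := hy
    exact ⟨max s t, add_mem (A.xxFil_mono p hk hz hdz (le_max_left s t) hs)
      (A.xxFil_mono p hk hz hdz (le_max_right s t) ht)⟩
  | single F α i a ha =>
    -- The filtration bounds weights strictly, hence the increment in the first entry.
    refine ⟨toLex ((ofLex (xxWt p F α)).1 + 1, 0), A.xxMono_mem_xxFil p hk hz hdz ha ?_⟩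
    exact Prod.Lex.toLex_lt_toLex.2 (Or.inl (Nat.lt_succ_self _))

theorem xxHtpy_mem_xxFil {t : ℕ ×ₗ ℕ} {f : (A.xxExt p hk hz hdz).carrier}
    (hf : f ∈ A.xxFil p hk hz hdz t) : A.xxHtpy p hk hz hdz f ∈ A.xxFil p hk hz hdz t := by
  refine (Submodule.span_le.2 ?_ : _ ≤ (A.xxFil p hk hz hdz t).comap (A.xxHtpy p hk hz hdz)) hf
  rintro _ ⟨F, α, n, a, ha, hw, rfl⟩
  change A.xxHtpy p hk hz hdz _ ∈ A.xxFil p hk hz hdz t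
  by_cases h : ∃ i, IsPush p F α i
  · obtain ⟨i, hi⟩ := h
    rw [A.xxHtpy_of_isPush hk hz hdz hi ha]
    refine zsmul_mem (A.xxMono_mem_xxFil p hk hz hdz ha ?_) _
    rwa [xxWt_push hi.2.1 hi.1]
  · rw [A.xxHtpy_of_forall_not hk hz hdz (by simpa using h)]; exact zero_mem _

/-- The leading part of the differential of `a x ^ α x'_F`, apart from `∂(a) x ^ α x'_F`. -/
def xxLead (F : Finset ℕ) (α : ℕ →₀ ℕ) (a : A.carrier) : (A.xxExt p hk hz hdz).carrier :=
  ∑ j ∈ F, ((-1 : ℤ) ^ (F.filter fun l => l < j).card) •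
    A.xxMono p hk hz hdz (F.erase j) (α + Finsupp.single j p) a

theorem d_xxMono_sub_mem (F : Finset ℕ) (α : ℕ →₀ ℕ) {n : ℕ} {a : A.carrier} (ha : a ∈ A.gr n) :
    (A.xxExt p hk hz hdz).d (A.xxMono p hk hz hdz F α a) -
      (A.xxMono p hk hz hdz F α (A.d a) + ((-1 : ℤ) ^ n) • A.xxLead p hk hz hdz F α a) ∈
    A.xxFil p hk hz hdz (xxWt p F α) := by
  rw [A.d_xxMono p hk hz hdz ha, add_assoc, add_sub_add_left_eq_sub, add_sub_assoc, ← smul_sub,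
    xxLead, ← Finset.sum_sub_distrib]
  refine add_mem (zsmul_mem (Submodule.sum_mem _ fun l hl => nsmul_mem ?_ _) _)
    (zsmul_mem (Submodule.sum_mem _ fun j hj => ?_) _)
  · exact A.xxMono_mem_xxFil p hk hz hdz (SetLike.GradedMul.mul_mem ha hz)
      (xxWt_lowExp_lt F (Finsupp.mem_support_iff.1 hl))
  · rw [← smul_sub, sub_sub_cancel_left]
    exact zsmul_mem (neg_mem (nsmul_mem
      (A.xxMono_mem_xxFil p hk hz hdz ha (xxWt_erase_lt α hj)) _)) _

end Homotopy

/-! ### The homotopy identity up to smaller weight, and acyclicity of the kernel. -/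

section Acyclic

/-- The homotopy applied to the differential of a monomial, up to terms of smaller weight. -/
theorem xxHtpy_d_mem (F : Finset ℕ) (α : ℕ →₀ ℕ) {n : ℕ} {a : A.carrier} (ha : a ∈ A.gr n) :
    A.xxHtpy p hk hz hdz ((A.xxExt p hk hz hdz).d (A.xxMono p hk hz hdz F α a)) -
      (A.xxHtpy p hk hz hdz (A.xxMono p hk hz hdz F α (A.d a)) +
        ((-1 : ℤ) ^ n) • ∑ j ∈ F, ((-1 : ℤ) ^ (F.filter fun l => l < j).card) •
          A.xxHtpy p hk hz hdz
            (A.xxMono p hk hz hdz (F.erase j) (α + Finsupp.single j p) a)) ∈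
    A.xxFil p hk hz hdz (xxWt p F α) := by
  have h := A.xxHtpy_mem_xxFil p hk hz hdz (A.d_xxMono_sub_mem p hk hz hdz F α ha)
  rw [map_sub, map_add, map_zsmul, xxLead, map_sum] at h
  simpa only [map_zsmul] using h

/-- No element of F is i or smaller, so replacing x'_(j+1) by x_j^p happens beyond i and h still
acts at i. -/
theorem isPush_erase {F : Finset ℕ} {α : ℕ →₀ ℕ} {i j : ℕ} (h : IsPush p F α i) (hj : j ∈ F) :
    IsPush p (F.erase j) (α + Finsupp.single j p) i := by
  refine ⟨?_, fun h' => h.2.1 (Finset.mem_of_mem_erase h'), fun l hl => ⟨?_, fun h' =>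
    (h.2.2 l hl).2 (Finset.mem_of_mem_erase h')⟩⟩
  · rw [Finsupp.add_apply]; exact h.1.trans (Nat.le_add_right _ _)
  · have : j ≠ l := fun e => (h.2.2 l hl).2 (e ▸ hj)
    rw [Finsupp.add_apply, Finsupp.single_eq_of_ne' this, add_zero]
    exact (h.2.2 l hl).1

theorem filter_lt_of_forall {F : Finset ℕ} {i : ℕ} (h : ∀ j < i, j ∉ F) :
    F.filter (fun l => l < i) = ∅ :=
  Finset.filter_eq_empty_iff.2 fun _ hl hlt => h _ hlt hl

/-- In ∂h the new x'_(i+1) returns the original monomial. Every other leading term occurs in ∂h and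
in h∂ with opposite signs, because inserting i in front of j shifts its position by one. -/
theorem homotopy_of_isPush {F : Finset ℕ} {α : ℕ →₀ ℕ} {i : ℕ} (hi : IsPush p F α i) {n : ℕ}
    {a : A.carrier} (ha : a ∈ A.gr n) :
    A.xxMono p hk hz hdz F α a -
      (A.xxExt p hk hz hdz).d (A.xxHtpy p hk hz hdz (A.xxMono p hk hz hdz F α a)) -
      A.xxHtpy p hk hz hdz ((A.xxExt p hk hz hdz).d (A.xxMono p hk hz hdz F α a)) ∈
    A.xxFil p hk hz hdz (xxWt p F α) := by
  have h1 := A.xxHtpy_d_mem p hk hz hdz F α ha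
  have h2 := A.d_xxMono_sub_mem p hk hz hdz (insert i F) (α - Finsupp.single i p) ha
  rw [xxWt_push hi.2.1 hi.1] at h2
  have e : Finsupp.single i p ≤ α := by rw [Finsupp.single_le_iff]; exact hi.1
  -- So i is the least element of `insert i F`, and the returned monomial carries no exterior sign.
  have hlow : ∀ j < i, j ∉ insert i F := fun j hj h => by
    rcases Finset.mem_insert.1 h with rfl | h
    · exact lt_irrefl _ hj
    · exact (hi.2.2 j hj).2 h
  -- The sign built into h makes it anticommute with the differential of A, whose degree is -1.
  have hd : A.xxHtpy p hk hz hdz (A.xxMono p hk hz hdz F α (A.d a)) = -(((-1 : ℤ) ^ n) •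
      A.xxMono p hk hz hdz (insert i F) (α - Finsupp.single i p) (A.d a)) := by
    rcases n with _ | n
    · rw [A.d_gr_zero ha]; simp
    · rw [A.xxHtpy_of_isPush hk hz hdz hi (A.d_gr_succ ha), pow_succ]; simp
  have hL : A.xxLead p hk hz hdz (insert i F) (α - Finsupp.single i p) a =
      A.xxMono p hk hz hdz F α a - ((-1 : ℤ) ^ n) •
        ∑ j ∈ F, ((-1 : ℤ) ^ (F.filter fun l => l < j).card) • A.xxHtpy p hk hz hdz
          (A.xxMono p hk hz hdz (F.erase j) (α + Finsupp.single j p) a) := by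
    rw [xxLead, Finset.sum_insert hi.2.1, filter_lt_of_forall hlow, Finset.erase_insert hi.2.1,
      tsub_add_cancel_of_le e, Finset.card_empty, pow_zero, one_smul, sub_eq_add_neg,
      Finset.smul_sum, ← Finset.sum_neg_distrib]
    congr 1
    refine Finset.sum_congr rfl fun j hj => ?_
    have hij : i < j := by
      rcases lt_trichotomy i j with h | rfl | h
      · exact h
      · exact absurd hj hi.2.1
      · exact absurd hj (hi.2.2 j h).2
    rw [A.xxHtpy_of_isPush hk hz hdz (isPush_erase p hi hj) ha, Finset.filter_insert, if_pos hij,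
      Finset.card_insert_of_notMem (fun h => hi.2.1 (Finset.mem_filter.1 h).1),
      Finset.erase_insert_of_ne hij.ne, tsub_add_eq_add_tsub e, smul_smul, smul_smul, ← neg_smul]
    congr 1
    have : ((-1 : ℤ) ^ n) * (-1) ^ n = 1 := by rw [← mul_pow]; simp
    rw [pow_succ]
    linear_combination ((-1 : ℤ) ^ (F.filter fun l => l < j).card) * this
  rw [hd] at h1
  rw [hL] at h2
  rw [A.xxHtpy_of_isPush hk hz hdz hi ha, map_zsmul]
  have h3 := neg_mem (add_mem h1 (zsmul_mem h2 ((-1 : ℤ) ^ n)))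
  convert h3 using 1
  have : ((-1 : ℤ) ^ n) * (-1) ^ n = 1 := by rw [← mul_pow]; simp
  simp only [smul_sub, smul_add, smul_smul, this, one_smul]
  abel

/-- Here h vanishes on the monomial, and in h∂ only the leading term that turns x'_(i+1) into x_i^p
survives; h turns it back. The other leading terms still contain x'_(i+1), so h vanishes on them
too. -/
theorem homotopy_of_pull {F : Finset ℕ} {α : ℕ →₀ ℕ} {i : ℕ} (hi : i ∈ F)
    (hlow : ∀ j < i, α j < p ∧ j ∉ F) {n : ℕ} {a : A.carrier} (ha : a ∈ A.gr n) :
    A.xxMono p hk hz hdz F α a -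
      (A.xxExt p hk hz hdz).d (A.xxHtpy p hk hz hdz (A.xxMono p hk hz hdz F α a)) -
      A.xxHtpy p hk hz hdz ((A.xxExt p hk hz hdz).d (A.xxMono p hk hz hdz F α a)) ∈
    A.xxFil p hk hz hdz (xxWt p F α) := by
  have hno : ∀ {G : Finset ℕ} {β : ℕ →₀ ℕ}, i ∈ G → (∀ j < i, β j < p) →
      ∀ l, ¬ IsPush p G β l := fun {G β} hG hβ l hl => by
    rcases lt_trichotomy i l with h | rfl | h
    · exact (hl.2.2 i h).2 hG
    · exact hl.2.1 hG
    · exact absurd (hβ l h) (not_lt.2 hl.1)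
  have h1 := A.xxHtpy_d_mem p hk hz hdz F α ha
  rw [A.xxHtpy_of_forall_not hk hz hdz (hno hi fun j hj => (hlow j hj).1), zero_add,
    ← Finset.add_sum_erase F _ hi, filter_lt_of_forall fun j hj => (hlow j hj).2,
    Finset.sum_eq_zero, add_zero, Finset.card_empty, pow_zero, one_smul,
    A.xxHtpy_of_isPush (i := i) hk hz hdz _ ha, Finset.insert_erase hi, add_tsub_cancel_right,
    smul_smul, ← mul_pow] at h1
  · rw [A.xxHtpy_of_forall_not hk hz hdz (hno hi fun j hj => (hlow j hj).1), map_zero, sub_zero,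
      ← neg_sub]
    refine neg_mem ?_
    simpa using h1
  · refine ⟨by simp, by simp, fun j hj => ⟨?_, fun h => (hlow j hj).2 (Finset.mem_of_mem_erase h)⟩⟩
    rw [Finsupp.add_apply, Finsupp.single_eq_of_ne' hj.ne', add_zero]
    exact (hlow j hj).1
  · intro j hj
    obtain ⟨hji, hj⟩ := Finset.mem_erase.1 hj
    rw [A.xxHtpy_of_forall_not hk hz hdz (hno (Finset.mem_erase.2 ⟨hji.symm, hi⟩) fun l hl => ?_),
      smul_zero]
    have : j ≠ l := fun e => (hlow l hl).2 (e ▸ hj)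
    rw [Finsupp.add_apply, Finsupp.single_eq_of_ne' this, add_zero]
    exact (hlow l hl).1

variable [IsLocalRing R] [CharP (IsLocalRing.ResidueField R) p]

/-- Up to terms of smaller weight, `xxHtpy` is a homotopy from the identity to
`dpSection ∘ xxEvalLin`. -/
theorem homotopy_mem (F : Finset ℕ) (α : ℕ →₀ ℕ) {n : ℕ} {a : A.carrier} (ha : a ∈ A.gr n) :
    A.xxMono p hk hz hdz F α a -
      (A.xxExt p hk hz hdz).d (A.xxHtpy p hk hz hdz (A.xxMono p hk hz hdz F α a)) -
      A.xxHtpy p hk hz hdz ((A.xxExt p hk hz hdz).d (A.xxMono p hk hz hdz F α a)) -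
      A.dpSection p hk hz hdz (A.xxEvalLin p hk hz hdz (A.xxMono p hk hz hdz F α a)) ∈
    A.xxFil p hk hz hdz (xxWt p F α) := by
  -- The first index at which the monomial is not reduced decides between the push and the pull
  -- case.
  by_cases hex : ∃ i, p ≤ α i ∨ i ∈ F
  · have hlow : ∀ j < Nat.find hex, α j < p ∧ j ∉ F := fun j hj => by
      simpa using Nat.find_min hex hj
    -- For a non-reduced monomial the term sε is itself negligible: it is 0, or a multiple of the
    -- reduced monomial of the same value and smaller degree.
    have hs : A.dpSection p hk hz hdz (A.xxEvalLin p hk hz hdz (A.xxMono p hk hz hdz F α a)) ∈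
        A.xxFil p hk hz hdz (xxWt p F α) := by
      by_cases hF : F = ∅
      · subst hF
        rw [xxEvalLin_empty, map_nsmul, dpSection_dpMono]
        obtain ⟨i, hi⟩ := hex
        exact nsmul_mem (Submodule.smul_mem _ _ (A.xxMono_mem_xxFil p hk hz hdz ha
          (xxWt_digitExp_lt (hi.resolve_right (Finset.notMem_empty i))))) _
      · rw [A.xxEvalLin_nonempty p hk hz hdz hF, map_zero]; exact zero_mem _
    refine sub_mem ?_ hs
    by_cases hF : Nat.find hex ∈ F
    · exact A.homotopy_of_pull p hk hz hdz hF hlow ha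
    · exact A.homotopy_of_isPush p hk hz hdz
        ⟨(Nat.find_spec hex).resolve_right hF, hF, hlow⟩ ha
  -- On a reduced monomial sε is the identity, h is 0, and h∂ is of smaller weight.
  · simp only [not_exists, not_or, not_le] at hex
    obtain rfl : F = ∅ := Finset.eq_empty_iff_forall_notMem.2 fun i => (hex i).2
    have hno : ∀ i, ¬ IsPush p ∅ α i := fun i hi => absurd (hex i).1 (not_lt.2 hi.1)
    have hα := digitExp_monVal p fun i => (hex i).1
    have hu := isUnit_natCast_of_not_dvd R p (not_dvd_monCoeff_digitExp p (monVal p α))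
    have h1 := A.xxHtpy_d_mem p hk hz hdz ∅ α ha
    rw [A.xxHtpy_of_forall_not hk hz hdz hno, Finset.sum_empty, smul_zero, add_zero,
      sub_zero] at h1
    rw [A.xxHtpy_of_forall_not hk hz hdz hno, map_zero, sub_zero, xxEvalLin_empty, map_nsmul,
      dpSection_dpMono, ← Nat.cast_smul_eq_nsmul R, smul_smul]
    rw [hα] at hu ⊢
    rw [Ring.mul_inverse_cancel _ hu, one_smul, sub_right_comm, sub_self, zero_sub]
    exact neg_mem h1

/-- The alternative f = 0 is needed for the least t, below which there is no s; it also starts the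
induction over the span. -/
theorem exists_lt_homotopy_mem {t : ℕ ×ₗ ℕ} {f : (A.xxExt p hk hz hdz).carrier}
    (hf : f ∈ A.xxFil p hk hz hdz t) : f = 0 ∨ ∃ s < t,
      f - (A.xxExt p hk hz hdz).d (A.xxHtpy p hk hz hdz f) -
        A.xxHtpy p hk hz hdz ((A.xxExt p hk hz hdz).d f) -
        A.dpSection p hk hz hdz (A.xxEvalLin p hk hz hdz f) ∈ A.xxFil p hk hz hdz s := by
  induction hf using Submodule.span_induction with
  | mem f h =>
    obtain ⟨F, α, i, a, ha, hw, rfl⟩ := h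
    exact Or.inr ⟨_, hw, A.homotopy_mem p hk hz hdz F α ha⟩
  | zero => exact Or.inl rfl
  | add f g _ _ hf hg =>
    rcases hf with rfl | ⟨s, hs, hf⟩
    · rwa [zero_add]
    rcases hg with rfl | ⟨s', hs', hg⟩
    · rw [add_zero]; exact Or.inr ⟨s, hs, hf⟩
    refine Or.inr ⟨max s s', max_lt hs hs', ?_⟩
    have := add_mem (A.xxFil_mono p hk hz hdz (le_max_left s s') hf)
      (A.xxFil_mono p hk hz hdz (le_max_right s s') hg)
    convert this using 1
    simp only [map_add]
    abel
  | smul r f _ hf =>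
    rcases hf with rfl | ⟨s, hs, hf⟩
    · exact Or.inl (smul_zero r)
    refine Or.inr ⟨s, hs, ?_⟩
    simpa only [map_smul, ← smul_sub] using Submodule.smul_mem _ r hf

/-- The kernel of the morphism is acyclic. -/
theorem exists_d_eq_of_xxEvalLin_eq_zero {n : ℕ} {f : (A.xxExt p hk hz hdz).carrier}
    (hf : f ∈ (A.xxExt p hk hz hdz).gr n) (hdf : (A.xxExt p hk hz hdz).d f = 0)
    (hef : A.xxEvalLin p hk hz hdz f = 0) :
    ∃ g ∈ (A.xxExt p hk hz hdz).gr (n + 1), (A.xxExt p hk hz hdz).d g = f ∧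
      A.xxEvalLin p hk hz hdz g = 0 := by
  obtain ⟨t, ht⟩ := A.exists_mem_xxFil p hk hz hdz f
  induction t using WellFoundedLT.induction generalizing f with
  | ind t ih =>
  rcases A.exists_lt_homotopy_mem p hk hz hdz ht with rfl | ⟨s, hs, h⟩
  · exact ⟨0, zero_mem _, map_zero _, map_zero _⟩
  -- For a cycle in the kernel only f - ∂hf is left, and a primitive g of it gives the primitive g +
  -- hf of f.
  rw [hdf, hef, map_zero, map_zero, sub_zero, sub_zero] at h
  have hmem := A.xxHtpy_mem p hk hz hdz hf
  obtain ⟨g, hg, hdg, heg⟩ := ih s hs (sub_mem hf ((A.xxExt p hk hz hdz).d_gr_succ hmem))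
    (by rw [map_sub, hdf, (A.xxExt p hk hz hdz).d_d, sub_zero])
    (by rw [map_sub, hef, xxEvalLin_d, xxEvalLin_xxHtpy, map_zero, sub_zero]) h
  exact ⟨g + A.xxHtpy p hk hz hdz f, add_mem hg hmem, by rw [map_add, hdg, sub_add_cancel],
    by rw [map_add, heg, xxEvalLin_xxHtpy, add_zero]⟩

theorem xxEval_isQuasiIso : (A.xxEval p hk hz hdz).IsQuasiIso :=
  DGHom.isQuasiIso_of_surjective_of_acyclic _
    (fun _ b hb => ⟨A.dpSection p hk hz hdz b, A.dpSection_mem p hk hz hdz hb,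
      A.xxEvalLin_dpSection p hk hz hdz b⟩)
    (fun _ _ hu hdu hfu => A.exists_d_eq_of_xxEvalLin_eq_zero p hk hz hdz hu hdu hfu)

end Acyclic

end DGAlgebra

end

theorem mainTheorem8 {R : Type u} [CommRing R] [IsLocalRing R] (p : ℕ) [Fact p.Prime]
    [CharP (IsLocalRing.ResidueField R) p] (A : DGAlgebra.{u, v} R) {k : ℕ} (hk : Odd k)
    {z : A.carrier} (hz : z ∈ A.gr k) (hdz : A.d z = 0) :
    ∃ f : DGHom (A.xxExt p hk hz hdz) (A.adjoinDP hk hz hdz),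
      (∀ a : A.carrier, f (A.xxIncl p hk hz hdz a) = A.adjoinDPIncl hk hz hdz a) ∧
      (∀ i : ℕ, f (A.xxVar p hk hz hdz i) = dCoeff p i • A.dpPow hk hz hdz (p ^ i)) ∧
      (∀ i : ℕ, f (A.xxVar' p hk hz hdz i) = 0) ∧
      (∀ g : DGHom (A.xxExt p hk hz hdz) (A.adjoinDP hk hz hdz),
        (∀ a : A.carrier, g (A.xxIncl p hk hz hdz a) = A.adjoinDPIncl hk hz hdz a) →
        (∀ i : ℕ, g (A.xxVar p hk hz hdz i) = dCoeff p i • A.dpPow hk hz hdz (p ^ i)) →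
        (∀ i : ℕ, g (A.xxVar' p hk hz hdz i) = 0) → g = f) ∧
      f.IsQuasiIso :=
  ⟨A.xxEval p hk hz hdz, A.xxEval_incl p hk hz hdz, A.xxEval_xxVar p hk hz hdz,
    A.xxEval_xxVar' p hk hz hdz, fun _ h hx hx' => DGAlgebra.dgHom_ext_xx
      (fun a => (h a).trans (A.xxEval_incl p hk hz hdz a).symm)
      (fun i => (hx i).trans (A.xxEval_xxVar p hk hz hdz i).symm)
      (fun i => (hx' i).trans (A.xxEval_xxVar' p hk hz hdz i).symm),
    A.xxEval_isQuasiIso p hk hz hdz⟩
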